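/- Let $G$ be a connected (real, finite-dimensional, smooth) Lie group with identity $e$ and Lie algebra $\mathfrak g=T_eG$ with its usual bracket; for $Z\in\mathfrak g$ let $Z^R(g)=d(R_g)_eZ$ denote the right-invariant vector field of $Z$. Let $m\ge 0$ and $U\subset\mathbb R^m$. Let $\mathcal X_0,\dots,\mathcal X_m$ be linear vector fields on $G$ (smooth vector fields whose flows consist of automorphisms of $G$) and let $Y_0,\dots,Y_m\in\mathfrak g$. Assume that the derivations $\mathcal D_i(Z)=-[\mathcal X_i,Z^R](e)$ of $\mathfrak g$ are inner, $\mathcal D_i=\operatorname{ad}(X_i)$ with $X_i\in\mathfrak g$, and that the $X_i$ commute: $[X_i,X_j]=0$ for all $i,j=0,\dots,m$. Consider the control systems $$\Sigma_A:\ \frac{dg}{dt}=\bigl(\mathcal X_0+Y_0^R\bigr)(g)+\sum_{j=1}^m u_j\bigl(\mathcal X_j+Y_j^R\bigr)(g),\qquad \Sigma_I:\ \frac{dg}{dt}=(X_0+Y_0)^R(g)+\sum_{j=1}^m u_j\,(X_j+Y_j)^R(g),$$ where the admissible controls are the piecewise constant functions $u:\mathbb R\to U$. The reachable set of a system from $g$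 is the set of all points reached from $g$ at some time $T>0$ along solutions with admissible controls, and a system is controllable if its reachable set from every point is $G$. Let $\mathcal A$ be the reachable set of $\Sigma_A$ from $e$. Suppose that $\Sigma_I$ is controllable. Then the following are equivalent: (i) $\exp\bigl(t(X_0+\sum_{j=1}^m u_jX_j)\bigr)\in\mathcal A$ for every control value $u=(u_1,\dots,u_m)\in U$ and every $t\in\mathbb R$; (ii) $\Sigma_A$ is controllable. -/

import Mathlib

open Set Filter Topology
open scoped Manifold ContDiff

noncomputable section AffineControl

variable {E : Type*} [NormedAddCommGroup E] [NormedSpace ℝ E]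
  {H : Type*} [TopologicalSpace H] (I : ModelWithCorners ℝ E H)
  {G : Type*} [TopologicalSpace G] [ChartedSpace H G] [Group G]

/-- The right invariant vector field on `G` with value `v` at the identity:
`g ↦ d(R_g)_e v`, where `R_g x = x * g`. -/
def rightInvariantVectorField (v : GroupLieAlgebra I G) (g : G) : TangentSpace I g :=
  mfderiv I I (fun x : G => x * g) (1 : G) v

/-- The exponential map of the Lie group: `lieExp I v = γ 1`, where `γ` is the integral curve of
the right invariant vector field of `v` with `γ 0 = 1`. -/
def lieExp (v : GroupLieAlgebra I G) : G :=
  (Classical.epsilon fun γ : ℝ → G =>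
    γ 0 = 1 ∧ IsMIntegralCurve γ (rightInvariantVectorField I v)) 1

/-- A smooth vector field is linear if it is complete and its flow `φ t` consists of
automorphisms of the Lie group `G`. -/
def IsLinearVectorField [LieGroup I ∞ G] (V : (g : G) → TangentSpace I g) : Prop :=
  ContMDiff I I.tangent ∞ (fun g : G => (⟨g, V g⟩ : TangentBundle I G)) ∧
    ∃ φ : ℝ → G ≃* G, (∀ t, ContMDiff I I ∞ (φ t)) ∧
      (∀ g, φ 0 g = g) ∧ ∀ g, IsMIntegralCurve (fun t => φ t g) V

/-- The derivation `D(Y) = -[V, Y]` of a linear vector field `V`, where `Y` runs through the right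
invariant vector fields, and these are identified with their values at the identity. -/
def linearDerivation (V : (g : G) → TangentSpace I g) (Y : GroupLieAlgebra I G) :
    GroupLieAlgebra I G :=
  -VectorField.mlieBracket I V (rightInvariantVectorField I Y) (1 : G)

/-- The right hand side `V₀ + ∑ⱼ uⱼ Vⱼ` of a control-affine system, for the control value `u`. -/
def controlField {m : ℕ} (V : Fin (m + 1) → (g : G) → TangentSpace I g) (u : Fin m → ℝ) (g : G) :
    TangentSpace I g :=
  V 0 g + ∑ j, u j • V j.succ g

/-- A function of time is piecewise constant if on every compact interval it is locally constant
off a finite set. -/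
def IsPiecewiseConstant {α : Type*} (u : ℝ → α) : Prop :=
  ∀ a b : ℝ, ∃ D : Set ℝ, D.Finite ∧ ∀ s ∈ Icc a b \ D, ∀ᶠ r in 𝓝 s, u r = u s

/-- Admissible controls: piecewise constant functions with values in `U`. -/
def IsAdmissibleControl {m : ℕ} (U : Set (Fin m → ℝ)) (u : ℝ → Fin m → ℝ) : Prop :=
  (∀ s, u s ∈ U) ∧ IsPiecewiseConstant u

/-- `γ` solves `dγ/ds = V₀(γ) + ∑ⱼ uⱼ(s) Vⱼ(γ)` on `[0, T]`: it is continuous there and satisfies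
the equation off a finite set of times. -/
def IsSolutionOn {m : ℕ} (V : Fin (m + 1) → (g : G) → TangentSpace I g)
    (u : ℝ → Fin m → ℝ) (γ : ℝ → G) (T : ℝ) : Prop :=
  ContinuousOn γ (Icc 0 T) ∧
    ∃ D : Set ℝ, D.Finite ∧ ∀ s ∈ Ioo 0 T \ D,
      HasMFDerivAt 𝓘(ℝ, ℝ) I γ s ((1 : ℝ →L[ℝ] ℝ).smulRight (controlField I V (u s) (γ s)))

/-- The set of points that the system reaches from `g` at time exactly `T`. -/
def reachableAt {m : ℕ} (V : Fin (m + 1) → (g : G) → TangentSpace I g)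
    (U : Set (Fin m → ℝ)) (T : ℝ) (g : G) : Set G :=
  {h | ∃ u, IsAdmissibleControl U u ∧ ∃ γ, IsSolutionOn I V u γ T ∧ γ 0 = g ∧ γ T = h}

/-- The reachable set from `g`: the union over all times `T > 0`. -/
def reachableSet {m : ℕ} (V : Fin (m + 1) → (g : G) → TangentSpace I g)
    (U : Set (Fin m → ℝ)) (g : G) : Set G :=
  ⋃ (T : ℝ) (_ : 0 < T), reachableAt I V U T g

/-- Controllability: every point is reachable from every point. -/
def IsControllable {m : ℕ} (V : Fin (m + 1) → (g : G) → TangentSpace I g)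
    (U : Set (Fin m → ℝ)) : Prop :=
  ∀ g : G, reachableSet I V U g = univ

/-- The vector fields `𝒳ᵢ + Yᵢ` of the affine system `Σ_A`. -/
def affineFields {m : ℕ} (𝒳 : Fin (m + 1) → (g : G) → TangentSpace I g)
    (Y : Fin (m + 1) → GroupLieAlgebra I G) : Fin (m + 1) → (g : G) → TangentSpace I g :=
  fun i g => 𝒳 i g + rightInvariantVectorField I (Y i) g

/-- The right invariant vector fields `Xᵢ + Yᵢ` of the invariant system `Σ_I`. -/
def invariantFields {m : ℕ} (X Y : Fin (m + 1) → GroupLieAlgebra I G) :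
    Fin (m + 1) → (g : G) → TangentSpace I g :=
  fun i => rightInvariantVectorField I (X i + Y i)

end AffineControl

/-!
# Controllability of affine systems with inner derivations

Write `X_u = X₀ + ∑ⱼ uⱼ Xⱼ` for a control value `u`, and similarly `Y_u`. A linear vector field `𝒳`
with derivation `ad X` on a connected group is the difference of the right and the left invariant
vector fields of `X` (`isLinearVectorField_eq_sub`). Hence the solution of the affine system from
`g` is `γ g p⁻¹`, where `γ` is the solution of the invariant system from the identity for the same
control, and the drift `p` solves `dp/ds = (X_u)^R (p)`, `p 0 = 1`
(`mul_inv_mem_reachableSet`). For piecewise constant controls, `p` is a product of exponentials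
`exp (t X_u)` (`exists_isDrift`).

Since the `Xᵢ` commute, all linear fields `𝒳ᵢ` vanish at the points `exp (t X_u)`
(`linearVectorField_lieExp_controlSum_eq_zero`), and right translation by a common zero of the
`𝒳ᵢ` maps solutions of the affine system to solutions (`mul_mem_reachableSet`). If all
`exp (t X_u)` are reachable from the identity, it follows that they generate a subgroup `N` within
which the affine system can be steered from any point to any other. To steer it from `g` to `h`,
choose a control that steers the invariant system from `1` to `g⁻¹`: it steers the affine system
from `g` to a point of `N`. Similarly some point of `N` is steered to `h`, so it remains to move
inside `N`. The converse implication is immediate.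

Both facts about linear fields `𝒳` come from the right trivialization
`w g = d(R_{g⁻¹})_g (𝒳 g)` (`rightTriv`), which is a cocycle, `w (g h) = w g + Ad g (w h)`
(`IsMultiplicative.rightTriv_mul`), whose derivative at the identity is the derivation of `𝒳`
(`linearDerivation_eq_trivDeriv`). If this derivative kills `z`, then `w` is constant along
`t ↦ exp (t z)` (`IsMultiplicative.eq_zero_lieExp`). If it vanishes, then `w` is locally constant
(`cocycle_eq_zero`); this is applied to `w g - X + Ad g X`, whose derivative at the identity is
zero as the differential of `Ad` is `ad` (`trivDeriv_mulInvariantVectorField`).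
-/

noncomputable section

open VectorField Bundle

namespace AffineControl

/-! ### Derivatives of translations and velocities of curves -/

section

variable {E : Type*} [NormedAddCommGroup E] [NormedSpace ℝ E]
  {H : Type*} [TopologicalSpace H] (I : ModelWithCorners ℝ E H)
  {G : Type*} [TopologicalSpace G] [ChartedSpace H G]

/-- The curve `γ` has velocity `v` at time `s`. -/
def HasVelocityAt (γ : ℝ → G) (s : ℝ) (v : E) : Prop :=
  HasMFDerivAt 𝓘(ℝ, ℝ) I γ s ((1 : ℝ →L[ℝ] ℝ).smulRight (M₂ := E) v)

variable {I}

lemma HasVelocityAt.unique {γ : ℝ → G} {s : ℝ} {v w : E} (hv : HasVelocityAt I γ s v)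
    (hw : HasVelocityAt I γ s w) : v = w := by
  have h := hasMFDerivAt_unique hv hw
  have h' := congrArg (fun L : ℝ →L[ℝ] E => L 1) h
  simpa using h'

lemma HasVelocityAt.congr {γ δ : ℝ → G} {s : ℝ} {v : E} (hv : HasVelocityAt I γ s v)
    (h : δ =ᶠ[𝓝 s] γ) : HasVelocityAt I δ s v :=
  HasMFDerivAt.congr_of_eventuallyEq hv h

lemma HasVelocityAt.comp {F : Type*} [NormedAddCommGroup F] [NormedSpace ℝ F]
    {K : Type*} [TopologicalSpace K] {J : ModelWithCorners ℝ F K} {M : Type*} [TopologicalSpace M]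
    [ChartedSpace K M]
    {γ : ℝ → G} {s : ℝ} {v : E} (hv : HasVelocityAt I γ s v) {f : G → M} {f' : E →L[ℝ] F}
    (hf : HasMFDerivAt I J f (γ s) f') :
    HasMFDerivAt 𝓘(ℝ, ℝ) J (fun t => f (γ t)) s ((1 : ℝ →L[ℝ] ℝ).smulRight (M₂ := F) (f' v)) := by
  have := HasMFDerivAt.comp s hf hv
  refine HasMFDerivAt.congr_mfderiv this ?_
  refine ContinuousLinearMap.ext_ring (M₁ := F) ?_
  show f' (((1 : ℝ →L[ℝ] ℝ).smulRight (M₂ := E) v) 1) = _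
  simp
  exact (one_smul ℝ (f' v)).symm

lemma HasVelocityAt.scomp {γ : ℝ → G} {s : ℝ} {v : E} {a : ℝ → ℝ} {a' : ℝ}
    (hv : HasVelocityAt I γ (a s) v) (ha : HasDerivAt a a' s) :
    HasVelocityAt I (fun t => γ (a t)) s (a' • v) := by
  have := HasMFDerivAt.comp s hv ha.hasFDerivAt.hasMFDerivAt
  unfold HasVelocityAt
  refine HasMFDerivAt.congr_mfderiv this ?_
  refine ContinuousLinearMap.ext_ring (M₁ := E) ?_
  show ((1 : ℝ →L[ℝ] ℝ).smulRight (M₂ := E) v) ((ContinuousLinearMap.toSpanSingleton ℝ a') 1) = _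
  simp
  exact (one_smul ℝ (a' • v)).symm

variable [Group G]

variable (I) in
/-- The derivative at `g` of the right translation `x ↦ x * h`. Tangent spaces are definitionally
the model space `E`; with values in `E →L[ℝ] E`, derivatives at points that agree only
propositionally can be compared. -/
def rightDeriv (h g : G) : E →L[ℝ] E := mfderiv I I (fun x : G => x * h) g

variable (I) in
/-- The derivative at `g` of the left translation `x ↦ h * x`, as an endomorphism of `E`. -/
def leftDeriv (h g : G) : E →L[ℝ] E := mfderiv I I (fun x : G => h * x) g

lemma rightDeriv_one (g : G) : rightDeriv I 1 g = ContinuousLinearMap.id ℝ E := by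
  have : (fun x : G => x * 1) = id := by ext; simp
  unfold rightDeriv
  rw [this]
  exact mfderiv_id

lemma leftDeriv_one (g : G) : leftDeriv I 1 g = ContinuousLinearMap.id ℝ E := by
  have : (fun x : G => 1 * x) = id := by ext; simp
  unfold leftDeriv
  rw [this]
  exact mfderiv_id

variable [LieGroup I ∞ G]

lemma contMDiff_mul_infty : ContMDiff (I.prod I) I ∞ (fun p : G × G => p.1 * p.2) :=
  contMDiff_mul I ∞

lemma mdifferentiableAt_mul_right (h g : G) : MDifferentiableAt I I (fun x : G => x * h) g :=
  (contMDiff_mul_right (I := I) (n := ∞)).contMDiffAt.mdifferentiableAt (by simp)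

lemma mdifferentiableAt_mul_left (h g : G) : MDifferentiableAt I I (fun x : G => h * x) g :=
  (contMDiff_mul_left (I := I) (n := ∞)).contMDiffAt.mdifferentiableAt (by simp)

lemma hasMFDerivAt_mul_right (h g : G) :
    HasMFDerivAt I I (fun x : G => x * h) g (rightDeriv I h g : E →L[ℝ] E) :=
  (mdifferentiableAt_mul_right h g).hasMFDerivAt

lemma hasMFDerivAt_mul_left (h g : G) :
    HasMFDerivAt I I (fun x : G => h * x) g (leftDeriv I h g : E →L[ℝ] E) :=
  (mdifferentiableAt_mul_left h g).hasMFDerivAt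

lemma rightDeriv_rightDeriv (k h g : G) (v : E) :
    rightDeriv I k (g * h) (rightDeriv I h g v) = rightDeriv I (h * k) g v := by
  have h1 := HasMFDerivAt.comp g (hasMFDerivAt_mul_right (I := I) k (g * h))
    (hasMFDerivAt_mul_right h g)
  have h2 : ((fun x : G => x * k) ∘ fun x => x * h) = fun x => x * (h * k) := by
    ext; simp [mul_assoc]
  rw [h2] at h1
  exact congrArg (fun L : E →L[ℝ] E => L v)
    (hasMFDerivAt_unique h1 (hasMFDerivAt_mul_right (h * k) g))

lemma leftDeriv_leftDeriv (k h g : G) (v : E) :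
    leftDeriv I k (h * g) (leftDeriv I h g v) = leftDeriv I (k * h) g v := by
  have h1 := HasMFDerivAt.comp g (hasMFDerivAt_mul_left (I := I) k (h * g))
    (hasMFDerivAt_mul_left h g)
  have h2 : ((fun x : G => k * x) ∘ fun x => h * x) = fun x => (k * h) * x := by
    ext; simp [mul_assoc]
  rw [h2] at h1
  exact congrArg (fun L : E →L[ℝ] E => L v)
    (hasMFDerivAt_unique h1 (hasMFDerivAt_mul_left (k * h) g))

lemma leftDeriv_rightDeriv (h k g : G) (v : E) :
    leftDeriv I h (g * k) (rightDeriv I k g v) = rightDeriv I k (h * g) (leftDeriv I h g v) := by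
  have h1 := HasMFDerivAt.comp g (hasMFDerivAt_mul_left (I := I) h (g * k))
    (hasMFDerivAt_mul_right k g)
  have h2 := HasMFDerivAt.comp g (hasMFDerivAt_mul_right (I := I) k (h * g))
    (hasMFDerivAt_mul_left h g)
  have h3 : ((fun x : G => h * x) ∘ fun x => x * k) = (fun x => x * k) ∘ (fun x => h * x) := by
    ext; simp [mul_assoc]
  rw [h3] at h1
  exact congrArg (fun L : E →L[ℝ] E => L v) (hasMFDerivAt_unique h1 h2)

lemma rightDeriv_inv_rightDeriv (h g : G) (v : E) :
    rightDeriv I h⁻¹ (g * h) (rightDeriv I h g v) = v := by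
  rw [rightDeriv_rightDeriv, mul_inv_cancel, rightDeriv_one]; rfl

lemma leftDeriv_inv_leftDeriv (h g : G) (v : E) :
    leftDeriv I h⁻¹ (h * g) (leftDeriv I h g v) = v := by
  rw [leftDeriv_leftDeriv, inv_mul_cancel, leftDeriv_one]; rfl

lemma mfderiv_mul_apply (g h : G) (v w : E) :
    (mfderiv (I.prod I) I (fun p : G × G => p.1 * p.2) (g, h) : E × E →L[ℝ] E) (v, w)
      = rightDeriv I h g v + leftDeriv I g h w :=
  mfderiv_prod_eq_add_apply (p := (g, h)) (v := (v, w))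
    (contMDiff_mul_infty.contMDiffAt.mdifferentiableAt (by simp))

lemma HasVelocityAt.mul {γ δ : ℝ → G} {s : ℝ} {v w : E} (hγ : HasVelocityAt I γ s v)
    (hδ : HasVelocityAt I δ s w) :
    HasVelocityAt I (fun t => γ t * δ t) s
      (rightDeriv I (δ s) (γ s) v + leftDeriv I (γ s) (δ s) w) := by
  have h1 := HasMFDerivAt.prodMk hγ hδ
  have h2 : HasMFDerivAt (I.prod I) I (fun p : G × G => p.1 * p.2) (γ s, δ s) _ :=
    (contMDiff_mul_infty.contMDiffAt.mdifferentiableAt (by simp)).hasMFDerivAt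
  have h3 := HasMFDerivAt.comp s h2 h1
  unfold HasVelocityAt
  refine HasMFDerivAt.congr_mfderiv h3 ?_
  refine ContinuousLinearMap.ext_ring (M₁ := E) ?_
  rw [← mfderiv_mul_apply]
  show (mfderiv (I.prod I) I (fun p : G × G => p.1 * p.2) (γ s, δ s) : E × E →L[ℝ] E)
    (((1 : ℝ →L[ℝ] ℝ).smulRight (M₂ := E) v) 1, ((1 : ℝ →L[ℝ] ℝ).smulRight (M₂ := E) w) 1) = _
  simp
  exact (one_smul ℝ (_ : E)).symm

lemma HasVelocityAt.mul_const {γ : ℝ → G} {s : ℝ} {v : E} (hγ : HasVelocityAt I γ s v) (h : G) :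
    HasVelocityAt I (fun t => γ t * h) s (rightDeriv I h (γ s) v) :=
  hγ.comp (hasMFDerivAt_mul_right h (γ s))

lemma HasVelocityAt.const_mul {γ : ℝ → G} {s : ℝ} {v : E} (hγ : HasVelocityAt I γ s v) (h : G) :
    HasVelocityAt I (fun t => h * γ t) s (leftDeriv I h (γ s) v) :=
  hγ.comp (hasMFDerivAt_mul_left h (γ s))

lemma hasMFDerivAt_inv (g : G) :
    HasMFDerivAt I I (fun x : G => x⁻¹) g (-(leftDeriv I g⁻¹ 1 ∘L rightDeriv I g⁻¹ g)) := by
  have h1 : HasMFDerivAt I I (fun x : G => x⁻¹) g (mfderiv I I (fun x : G => x⁻¹) g) :=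
    ((contMDiff_inv I ∞).contMDiffAt.mdifferentiableAt (by simp)).hasMFDerivAt
  set L : E →L[ℝ] E := mfderiv I I (fun x : G => x⁻¹) g with hL
  have h2 : HasMFDerivAt (I.prod I) I (fun p : G × G => p.1 * p.2) (g, g⁻¹) _ :=
    (contMDiff_mul_infty.contMDiffAt.mdifferentiableAt (by simp)).hasMFDerivAt
  have h3 := HasMFDerivAt.comp g h2 ((hasMFDerivAt_id g).prodMk h1)
  have h4 : ((fun p : G × G => p.1 * p.2) ∘ fun x : G => (id x, x⁻¹)) = fun _ => 1 := by
    ext; simp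
  rw [h4] at h3
  have h5 := hasMFDerivAt_unique h3 (hasMFDerivAt_const (I := I) (I' := I) (1 : G) g)
  have h6 : L = -(leftDeriv I g⁻¹ 1 ∘L rightDeriv I g⁻¹ g) := by
    ext v
    have h7 := congrArg (fun L : E →L[ℝ] E => L v) h5
    have h8 : rightDeriv I g⁻¹ g v + leftDeriv I g g⁻¹ (L v) = 0 := by
      rw [← mfderiv_mul_apply]; exact h7
    have h9 := congrArg (leftDeriv I g⁻¹ (g * g⁻¹)) h8
    rw [map_add, leftDeriv_inv_leftDeriv, map_zero, mul_inv_cancel] at h9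
    show L v = -(leftDeriv I g⁻¹ 1 (rightDeriv I g⁻¹ g v))
    exact eq_neg_of_add_eq_zero_right h9
  rw [← h6]
  exact h1

lemma HasVelocityAt.inv {γ : ℝ → G} {s : ℝ} {v : E} (hγ : HasVelocityAt I γ s v) :
    HasVelocityAt I (fun t => (γ t)⁻¹) s
      (-leftDeriv I (γ s)⁻¹ 1 (rightDeriv I (γ s)⁻¹ (γ s) v)) :=
  hγ.comp (hasMFDerivAt_inv (γ s))

end

/-! ### Smoothness of translated vector fields -/

section

variable {E : Type*} [NormedAddCommGroup E] [NormedSpace ℝ E]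
  {H : Type*} [TopologicalSpace H] {I : ModelWithCorners ℝ E H}
  {G : Type*} [TopologicalSpace G] [ChartedSpace H G] [Group G]

lemma rightInvariantVectorField_apply (v : GroupLieAlgebra I G) (g : G) :
    rightInvariantVectorField I v g = rightDeriv I g 1 v := rfl

variable [LieGroup I ∞ G]

/-- Translating tangent vectors by the derivative of multiplication is smooth in all variables,
because the tangent map of the multiplication `G × G → G` is smooth. -/
lemma contMDiff_rightDeriv_add_leftDeriv {f h : G → G} {A B : G → E}
    (hA : ContMDiff I I.tangent 1 (fun x => (⟨f x, A x⟩ : TangentBundle I G)))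
    (hB : ContMDiff I I.tangent 1 (fun x => (⟨h x, B x⟩ : TangentBundle I G))) :
    ContMDiff I I.tangent 1 (fun x => (⟨f x * h x,
      (rightDeriv I (h x) (f x) (A x) + leftDeriv I (f x) (h x) (B x) : E)⟩ :
        TangentBundle I G)) := by
  have S₁ := hA.prodMk hB
  have S₂ : ContMDiff (I.tangent.prod I.tangent) (I.prod I).tangent 1
    (equivTangentBundleProd I G I G).symm := contMDiff_equivTangentBundleProd_symm
  have S₃ : ContMDiff (I.prod I).tangent I.tangent 1
      (tangentMap (I.prod I) I (fun p : G × G => p.1 * p.2)) :=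
    contMDiff_mul_infty.contMDiff_tangentMap (m := 1) (by norm_cast)
  have S := (S₃.comp S₂).comp S₁
  convert! S using 2 with x
  rw [← mfderiv_mul_apply]
  rfl

lemma contMDiff_zero_section {h : G → G} (hh : ContMDiff I I 1 h) :
    ContMDiff I I.tangent 1 (fun x => (⟨h x, (0 : E)⟩ : TangentBundle I G)) :=
  (contMDiff_zeroSection ℝ (TangentSpace I : G → Type _)).comp hh

lemma contMDiff_rightInvariantVectorField (v : GroupLieAlgebra I G) :
    ContMDiff I I.tangent 1
      (fun g : G => (⟨g, rightInvariantVectorField I v g⟩ : TangentBundle I G)) := by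
  have h := contMDiff_rightDeriv_add_leftDeriv (I := I) (f := fun _ : G => 1) (h := fun g => g)
    (A := fun _ => v) (B := fun _ => 0) contMDiff_const (contMDiff_zero_section contMDiff_id)
  convert! h using 2 with g
  rw [one_mul, map_zero, add_zero]
  rfl

lemma mdifferentiableAt_rightInvariantVectorField (v : GroupLieAlgebra I G) (g : G) :
    MDifferentiableAt I I.tangent
      (fun g : G => (⟨g, rightInvariantVectorField I v g⟩ : TangentBundle I G)) g :=
  (contMDiff_rightInvariantVectorField v).contMDiffAt.mdifferentiableAt one_ne_zero

lemma contMDiff_leftInvariantVectorField (v : GroupLieAlgebra I G) :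
    ContMDiff I I.tangent 1
      (fun g : G => (⟨g, mulInvariantVectorField v g⟩ : TangentBundle I G)) := by
  have h := contMDiff_rightDeriv_add_leftDeriv (I := I) (f := fun g : G => g) (h := fun _ => 1)
    (A := fun _ => 0) (B := fun _ => v) (contMDiff_zero_section contMDiff_id) contMDiff_const
  convert! h using 2 with g
  rw [mul_one, map_zero, zero_add]
  rfl

/-- The right trivialization of a vector field: the function `G → E` that translates its values
back to the identity, `g ↦ d(R_{g⁻¹})_g (W g)`. -/
def rightTriv (W : (g : G) → TangentSpace I g) (g : G) : E := rightDeriv I g⁻¹ g (W g)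

lemma rightInvariantVectorField_rightTriv (W : (g : G) → TangentSpace I g) (g : G) :
    rightInvariantVectorField I (rightTriv W g : E) g = W g := by
  have h := rightDeriv_inv_rightDeriv (I := I) g⁻¹ g (W g)
  rw [inv_inv, mul_inv_cancel] at h
  exact h

lemma contMDiff_rightTriv {W : (g : G) → TangentSpace I g}
    (hW : ContMDiff I I.tangent 1 (fun g : G => (⟨g, W g⟩ : TangentBundle I G))) :
    ContMDiff I 𝓘(ℝ, E) 1 (rightTriv W) := by
  have h := contMDiff_rightDeriv_add_leftDeriv (I := I) (f := fun g : G => g) (h := fun g => g⁻¹)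
    (A := W) (B := fun _ => 0) hW
    (contMDiff_zero_section ((contMDiff_inv I ∞).of_le (by norm_cast)))
  have h' : ContMDiff I I.tangent 1
      (fun g : G => (⟨1, (rightTriv W g : E)⟩ : TangentBundle I G)) := by
    convert! h using 2 with g
    rw [mul_inv_cancel, map_zero, add_zero]
    rfl
  intro g
  have h2 := (contMDiffAt_totalSpace.1 (h' g)).2
  refine h2.congr_of_eventuallyEq (Eventually.of_forall fun x => ?_)
  have := (tangentBundleCore I G).coordChange_self (achart H (1 : G)) 1 (mem_chart_source H 1)
    (rightTriv W x)
  exact this.symm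

end

/-! ### The exponential map -/

section

variable {E : Type*} [NormedAddCommGroup E] [NormedSpace ℝ E]
  {H : Type*} [TopologicalSpace H] {I : ModelWithCorners ℝ E H}
  {G : Type*} [TopologicalSpace G] [ChartedSpace H G] [Group G]

lemma rightInvariantVectorField_smul (t : ℝ) (v : GroupLieAlgebra I G) :
    rightInvariantVectorField I (t • v) = t • rightInvariantVectorField (I := I) (G := G) v := by
  ext g
  exact (rightDeriv I g 1).map_smul t v

variable [LieGroup I ∞ G]

lemma rightDeriv_rightInvariantVectorField (v : GroupLieAlgebra I G) (h g : G) :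
    rightDeriv I h g (rightInvariantVectorField I v g) =
      rightInvariantVectorField I v (g * h) := by
  have := rightDeriv_rightDeriv (I := I) h g 1 v
  rw [one_mul] at this
  exact this

lemma HasVelocityAt.mul_const_rightInvariant {γ : ℝ → G} {s : ℝ} {v : GroupLieAlgebra I G}
    (hγ : HasVelocityAt I γ s (rightInvariantVectorField I v (γ s))) (h : G) :
    HasVelocityAt I (fun t => γ t * h) s (rightInvariantVectorField I v (γ s * h)) := by
  rw [← rightDeriv_rightInvariantVectorField]
  exact hγ.mul_const h

variable [I.Boundaryless] [T2Space G]

/-- The integral curve through the identity is unique, so that the choice in the definition of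
`lieExp` does not matter. -/
lemma eq_lieExp_of_isMIntegralCurve {v : GroupLieAlgebra I G} {c : ℝ → G} (h0 : c 0 = 1)
    (hc : IsMIntegralCurve c (rightInvariantVectorField I v)) : c 1 = lieExp I v := by
  have h := Classical.epsilon_spec (p := fun γ : ℝ → G =>
    γ 0 = 1 ∧ IsMIntegralCurve γ (rightInvariantVectorField I v)) ⟨c, h0, hc⟩
  have := isMIntegralCurve_Ioo_eq_of_contMDiff_boundaryless (t₀ := 0)
    (contMDiff_rightInvariantVectorField v) hc h.2 (h0.trans h.1.symm)
  exact congrFun this 1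

lemma lieExp_zero : lieExp I (0 : GroupLieAlgebra I G) = 1 :=
  (eq_lieExp_of_isMIntegralCurve (c := fun _ => 1) rfl
    (isMIntegralCurve_const (map_zero (rightDeriv I 1 1)))).symm

variable [CompleteSpace E]

/-- Right invariant vector fields are complete: a local integral curve through the identity
gives, by right translation, integral curves through all points with a common life time. -/
lemma exists_isMIntegralCurve_rightInvariantVectorField (v : GroupLieAlgebra I G) :
    ∃ c : ℝ → G, c 0 = 1 ∧ IsMIntegralCurve c (rightInvariantVectorField I v) := by
  have hv := contMDiff_rightInvariantVectorField (I := I) v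
  obtain ⟨γ, hγ0, hγ⟩ := exists_isMIntegralCurveAt_of_contMDiffAt_boundaryless 0
    (hv.contMDiffAt (x := (1 : G)))
  obtain ⟨ε, hε, hγ⟩ := isMIntegralCurveAt_iff'.1 hγ
  rw [Real.ball_eq_Ioo, zero_sub, zero_add] at hγ
  refine exists_isMIntegralCurve_of_isMIntegralCurveOn hv hε (fun x => ⟨fun t => γ t * x, ?_, ?_⟩) 1
  · simp [hγ0]
  · intro t ht
    have h1 : HasVelocityAt I γ t (rightInvariantVectorField I v (γ t)) :=
      (hγ t ht).hasMFDerivAt (isOpen_Ioo.mem_nhds ht)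
    exact HasMFDerivAt.hasMFDerivWithinAt (h1.mul_const_rightInvariant x)

/-- The curve `t ↦ exp (t v)` is the integral curve through the identity of the right invariant
vector field of `v`. -/
lemma isMIntegralCurve_lieExp (v : GroupLieAlgebra I G) :
    IsMIntegralCurve (fun t : ℝ => lieExp I (t • v)) (rightInvariantVectorField I v) := by
  obtain ⟨c, h0, hc⟩ := exists_isMIntegralCurve_rightInvariantVectorField (I := I) v
  convert! hc with t
  have h := hc.comp_mul t
  rw [← rightInvariantVectorField_smul] at h
  rw [← eq_lieExp_of_isMIntegralCurve (by simp [h0]) h]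
  simp

lemma lieExp_add_smul (v : GroupLieAlgebra I G) (s t : ℝ) :
    lieExp I ((s + t) • v) = lieExp I (s • v) * lieExp I (t • v) := by
  have h1 := (isMIntegralCurve_lieExp (I := I) v).comp_add t
  have h2 : IsMIntegralCurve (fun s : ℝ => lieExp I (s • v) * lieExp I (t • v))
      (rightInvariantVectorField I v) := fun s =>
    HasVelocityAt.mul_const_rightInvariant (isMIntegralCurve_lieExp (I := I) v s) _
  have := isMIntegralCurve_Ioo_eq_of_contMDiff_boundaryless (t₀ := 0)
    (contMDiff_rightInvariantVectorField v) h1 h2 (by simp [lieExp_zero])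
  exact congrFun this s

lemma lieExp_neg_smul (v : GroupLieAlgebra I G) (t : ℝ) :
    lieExp I ((-t) • v) = (lieExp I (t • v))⁻¹ := by
  rw [eq_inv_iff_mul_eq_one, ← lieExp_add_smul, neg_add_cancel, zero_smul, lieExp_zero]

lemma hasVelocityAt_lieExp (v : GroupLieAlgebra I G) (t : ℝ) :
    HasVelocityAt I (fun t : ℝ => lieExp I (t • v)) t
      (rightInvariantVectorField I v (lieExp I (t • v))) :=
  isMIntegralCurve_lieExp v t

lemma hasVelocityAt_lieExp_zero (v : GroupLieAlgebra I G) :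
    HasVelocityAt I (fun t : ℝ => lieExp I (t • v)) 0 v := by
  have h := hasVelocityAt_lieExp (I := I) v 0
  rw [zero_smul, lieExp_zero, rightInvariantVectorField_apply, rightDeriv_one] at h
  exact h

/-- Along the one-parameter group of `v`, the left and right invariant vector fields of `v`
coincide, as both are the derivative of `t ↦ exp ((s + t) v)` at `0`. -/
lemma leftDeriv_lieExp (v : GroupLieAlgebra I G) (s : ℝ) :
    leftDeriv I (lieExp I (s • v)) 1 v = rightDeriv I (lieExp I (s • v)) 1 v := by
  have h0 : HasVelocityAt I (fun t : ℝ => lieExp I ((t + s) • v)) 0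
      ((1 : ℝ) • (rightInvariantVectorField I v (lieExp I (s • v)) : E)) := by
    refine HasVelocityAt.scomp (γ := fun t : ℝ => lieExp I (t • v)) (a := fun t => t + s) ?_
      ((hasDerivAt_id (0 : ℝ)).add_const s)
    have := hasVelocityAt_lieExp (I := I) v s
    convert! this using 2
    simp
  have h1 := (hasVelocityAt_lieExp_zero (I := I) v).const_mul (lieExp I (s • v))
  simp only [← lieExp_add_smul, add_comm s, zero_smul, lieExp_zero] at h1
  rw [h1.unique h0, one_smul]
  rfl

end

/-! ### Lie brackets in the right trivialization -/

section

variable {E : Type*} [NormedAddCommGroup E] [NormedSpace ℝ E]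
  {H : Type*} [TopologicalSpace H] {I : ModelWithCorners ℝ E H}

lemma mlieBracket_sum_left {M : Type*} [TopologicalSpace M] [ChartedSpace H M] [IsManifold I 2 M]
    [CompleteSpace E] {ι : Type*} (s : Finset ι) (V : ι → (x : M) → TangentSpace I x)
    (W : (x : M) → TangentSpace I x) {x : M}
    (hV : ∀ k, MDifferentiableAt I I.tangent (fun y => (⟨y, V k y⟩ : TangentBundle I M)) x) :
    mlieBracket I (∑ k ∈ s, V k) W x = ∑ k ∈ s, mlieBracket I (V k) W x := by
  classical
  induction s using Finset.induction_on with
  | empty => simp [mlieBracket_zero_left]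
  | insert k s hk ih =>
    rw [Finset.sum_insert hk, Finset.sum_insert hk, mlieBracket_add_left (hV k), ih]
    have := MDifferentiableAt.sum_section (s := s) (fun k _ => hV k)
    convert! this with y
    simp

variable {G : Type*} [TopologicalSpace G] [ChartedSpace H G] [Group G]

/-- The derivative at the identity of a vector field in the right trivialization. -/
def trivDeriv (W : (g : G) → TangentSpace I g) : E →L[ℝ] E :=
  mfderiv I 𝓘(ℝ, E) (rightTriv W) 1

/-- The Lie bracket of two vector fields at the identity, as an element of `E`. -/
def bracketOne (V W : (g : G) → TangentSpace I g) : E := mlieBracket I V W 1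

lemma rightTriv_one (W : (g : G) → TangentSpace I g) : rightTriv W 1 = W 1 := by
  simp only [rightTriv, inv_one, rightDeriv_one]
  rfl

variable [LieGroup I ∞ G]

lemma rightTriv_rightInvariantVectorField (v : GroupLieAlgebra I G) (g : G) :
    rightTriv (rightInvariantVectorField I v) g = v := by
  have := rightDeriv_inv_rightDeriv (I := I) g 1 v
  rw [one_mul] at this
  exact this

lemma hasMFDerivAt_rightTriv {W : (g : G) → TangentSpace I g}
    (hW : ContMDiff I I.tangent 1 (fun g : G => (⟨g, W g⟩ : TangentBundle I G))) :
    HasMFDerivAt I 𝓘(ℝ, E) (rightTriv W) 1 (trivDeriv W : E →L[ℝ] E) :=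
  ((contMDiff_rightTriv hW).contMDiffAt.mdifferentiableAt one_ne_zero).hasMFDerivAt

variable [FiniteDimensional ℝ E]

/-- The Leibniz rule, applied to the expansion of `W` in a frame of right invariant vector
fields. -/
lemma mlieBracket_eq_sum {W : (g : G) → TangentSpace I g}
    (hW : ContMDiff I I.tangent 1 (fun g : G => (⟨g, W g⟩ : TangentBundle I G)))
    (V : (g : G) → TangentSpace I g) {ι : Type*} [Fintype ι] (b : Module.Basis ι ℝ E) :
    bracketOne W V = -trivDeriv W (V 1) +
      ∑ k, b.repr (W 1) k • bracketOne (rightInvariantVectorField I (b k)) V := by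
  have : IsManifold I 2 G := IsManifold.of_le (n := ∞) (by norm_cast)
  have := FiniteDimensional.complete ℝ E
  let p (k : ι) : E →L[ℝ] ℝ := (b.coord k).toContinuousLinearMap
  let f (k : ι) (g : G) : ℝ := p k (rightTriv W g)
  let R (k : ι) : (g : G) → TangentSpace I g := rightInvariantVectorField I (b k)
  have hf (k : ι) : HasMFDerivAt I 𝓘(ℝ, ℝ) (f k) 1 (p k ∘L trivDeriv W : E →L[ℝ] ℝ) :=
    HasMFDerivAt.comp (1 : G) (p k).hasMFDerivAt (hasMFDerivAt_rightTriv hW)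
  have hR (k : ι) := mdifferentiableAt_rightInvariantVectorField (I := I) (b k) (1 : G)
  have hsum : W = ∑ k, f k • R k := by
    ext g
    rw [Finset.sum_apply]
    conv_lhs => rw [← rightInvariantVectorField_rightTriv W g]
    have h1 : rightDeriv I g 1 (∑ k, b.repr (rightTriv W g) k • b k) =
      ∑ k, b.repr (rightTriv W g) k • rightDeriv I g 1 (b k) := by
      simp only [map_sum, map_smul]
    rw [b.sum_repr] at h1
    exact h1
  have h2 (k : ι) : bracketOne (f k • R k) V =
      - (p k (trivDeriv W (V 1))) • (b k : E) + b.repr (W 1) k • bracketOne (R k) V := by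
    unfold bracketOne
    rw [mlieBracket_smul_left (hf k).mdifferentiableAt (hR k)]
    have h3 : mvfderiv I (f k) 1 (V 1) = p k (trivDeriv W (V 1)) := by
      rw [mvfderiv, (hf k).mfderiv]
      rfl
    have h4 : f k 1 = b.repr (W 1) k := by
      show b.repr (rightTriv W 1) k = _
      rw [rightTriv_one]
    have h5 : R k 1 = (b k : E) := by
      show rightDeriv I 1 1 (b k) = _
      rw [rightDeriv_one]; rfl
    rw [h3, h4]
    exact congrArg (fun x : E => -(p k (trivDeriv W (V 1))) • x +
      b.repr (W 1) k • bracketOne (R k) V) h5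
  have h6 : bracketOne (∑ k, f k • R k) V = ∑ k, bracketOne (f k • R k) V :=
    mlieBracket_sum_left Finset.univ (fun k => f k • R k) V
      fun k => (hf k).mdifferentiableAt.smul_section (hR k)
  rw [← hsum] at h6
  rw [h6]
  simp_rw [h2]
  have h7 : ∑ k, p k (trivDeriv W (V 1)) • b k = trivDeriv W (V 1) :=
    b.sum_repr _
  rw [Finset.sum_add_distrib]
  conv_rhs => rw [← h7, ← Finset.sum_neg_distrib]
  simp_rw [neg_smul]
  rfl

/-- The bracket with `V` at the identity, compared with that of the right invariant vector field
with the same value there. -/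
lemma mlieBracket_eq_trivDeriv {W : (g : G) → TangentSpace I g}
    (hW : ContMDiff I I.tangent 1 (fun g : G => (⟨g, W g⟩ : TangentBundle I G)))
    (V : (g : G) → TangentSpace I g) :
    bracketOne W V = -trivDeriv W (V 1) +
      bracketOne (rightInvariantVectorField I (W 1)) V := by
  have b := Module.finBasis ℝ E
  have h1 := mlieBracket_eq_sum hW V b
  have h2 := mlieBracket_eq_sum (contMDiff_rightInvariantVectorField (W 1)) V b
  have h3 : trivDeriv (rightInvariantVectorField I (W 1)) = 0 := by
    have : rightTriv (rightInvariantVectorField I (W 1)) = fun _ => (W 1 : E) :=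
      funext fun g => rightTriv_rightInvariantVectorField _ g
    unfold trivDeriv
    rw [this]
    exact mfderiv_const
  have h4 : rightInvariantVectorField I (W 1) (1 : G) = W 1 := by
    show rightDeriv I 1 1 (W 1) = _
    rw [rightDeriv_one]; rfl
  have h5 : trivDeriv (rightInvariantVectorField I (W 1)) (V 1) = 0 := by
    rw [h3]; rfl
  rw [h5, h4, neg_zero, zero_add] at h2
  rw [h1, h2]

end

/-! ### The derivative of the adjoint representation -/

section

variable {E : Type*} [NormedAddCommGroup E] [NormedSpace ℝ E]
  {H : Type*} [TopologicalSpace H] {I : ModelWithCorners ℝ E H}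
  {G : Type*} [TopologicalSpace G] [ChartedSpace H G] [Group G]

lemma bracketOne_swap (V W : (g : G) → TangentSpace I g) : bracketOne V W = -bracketOne W V :=
  mlieBracket_swap_apply

lemma mulInvariantVectorField_one (v : GroupLieAlgebra I G) :
    mulInvariantVectorField v (1 : G) = v := by
  show leftDeriv I 1 1 v = _
  rw [leftDeriv_one]; rfl

lemma rightInvariantVectorField_one (v : GroupLieAlgebra I G) :
    rightInvariantVectorField I v (1 : G) = v := by
  show rightDeriv I 1 1 v = _
  rw [rightDeriv_one]; rfl

variable [LieGroup I ∞ G]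

lemma liegroup_minSmoothness : LieGroup I (minSmoothness ℝ 3) G :=
  LieGroup.of_le (n := ∞) (by rw [minSmoothness_of_isRCLikeNormedField]; norm_cast)

lemma trivDeriv_add {V W : (g : G) → TangentSpace I g}
    (hV : ContMDiff I I.tangent 1 (fun g : G => (⟨g, V g⟩ : TangentBundle I G)))
    (hW : ContMDiff I I.tangent 1 (fun g : G => (⟨g, W g⟩ : TangentBundle I G))) :
    trivDeriv (V + W) = trivDeriv V + trivDeriv W := by
  have h := (hasMFDerivAt_rightTriv hV).add (hasMFDerivAt_rightTriv hW)
  have h' : rightTriv V + rightTriv W = rightTriv (V + W) := by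
    ext g
    exact ((rightDeriv I g⁻¹ g).map_add _ _).symm
  rw [h'] at h
  exact h.mfderiv

lemma rightDeriv_inv_rightDeriv_one (h : G) (v : E) :
    rightDeriv I h⁻¹ h (rightDeriv I h 1 v) = v := by
  have := rightDeriv_inv_rightDeriv (I := I) h 1 v
  rwa [one_mul] at this

lemma rightDeriv_one_rightDeriv_inv (h : G) (v : E) :
    rightDeriv I h 1 (rightDeriv I h⁻¹ h v) = v := by
  have := rightDeriv_inv_rightDeriv (I := I) h⁻¹ h v
  rwa [mul_inv_cancel, inv_inv] at this

lemma leftDeriv_inv_leftDeriv_inv (h : G) (v : E) :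
    leftDeriv I h⁻¹ 1 (leftDeriv I h h⁻¹ v) = v := by
  have := leftDeriv_inv_leftDeriv (I := I) h h⁻¹ v
  rwa [mul_inv_cancel] at this

lemma leftDeriv_leftDeriv_inv_one (h : G) (v : E) :
    leftDeriv I h h⁻¹ (leftDeriv I h⁻¹ 1 v) = v := by
  have := leftDeriv_inv_leftDeriv (I := I) h⁻¹ 1 v
  rwa [mul_one, inv_inv] at this

lemma inverse_mfderiv_inv (g : G) : (mfderiv I I (fun x : G => x⁻¹) g).inverse =
    (-(rightDeriv I g 1 ∘L leftDeriv I g g⁻¹) : E →L[ℝ] E) := by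
  rw [(hasMFDerivAt_inv g).mfderiv]
  refine ContinuousLinearMap.inverse_eq ?_ ?_
  · refine ContinuousLinearMap.ext fun v : E => ?_
    show -(leftDeriv I g⁻¹ 1 (rightDeriv I g⁻¹ g (-(rightDeriv I g 1 (leftDeriv I g g⁻¹ v))))) = v
    rw [map_neg, map_neg, neg_neg, rightDeriv_inv_rightDeriv_one, leftDeriv_inv_leftDeriv_inv]
  · refine ContinuousLinearMap.ext fun v : E => ?_
    show -(rightDeriv I g 1 (leftDeriv I g g⁻¹ (-(leftDeriv I g⁻¹ 1 (rightDeriv I g⁻¹ g v))))) = v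
    rw [map_neg, map_neg, neg_neg, leftDeriv_leftDeriv_inv_one, rightDeriv_one_rightDeriv_inv]

lemma mpullback_inv_mulInvariantVectorField (v : GroupLieAlgebra I G) :
    mpullback I I (fun x : G => x⁻¹) (mulInvariantVectorField v) =
      rightInvariantVectorField I (-v) := by
  ext g
  rw [mpullback_apply, inverse_mfderiv_inv]
  exact (congrArg (fun x : E => -rightDeriv I g 1 x)
    (leftDeriv_leftDeriv_inv_one (E := E) g v)).trans
      (ContinuousLinearMap.map_neg (M := E) (M₂ := E) (rightDeriv I g 1) v).symm

variable [FiniteDimensional ℝ E]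

/-- The bracket of right invariant vector fields is the opposite of that of left invariant ones,
as inversion carries the left invariant field of `v` to the right invariant field of `-v`. -/
lemma bracketOne_rightInvariantVectorField (v w : GroupLieAlgebra I G) :
    bracketOne (rightInvariantVectorField I v) (rightInvariantVectorField I w) = -⁅v, w⁆ := by
  have := FiniteDimensional.complete ℝ E
  have := liegroup_minSmoothness (I := I) (G := G)
  have key (v w : GroupLieAlgebra I G) :
      bracketOne (rightInvariantVectorField I (-v)) (rightInvariantVectorField I (-w)) =
        -⁅v, w⁆ := by
    have h := mpullback_mlieBracket (I := I) (I' := I) (n := ∞) (f := fun x : G => x⁻¹)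
      (x₀ := (1 : G)) (mdifferentiableAt_mulInvariantVectorField v)
      (mdifferentiableAt_mulInvariantVectorField w) (contMDiff_inv I ∞).contMDiffAt
      (by rw [minSmoothness_of_isRCLikeNormedField]; norm_cast)
    rw [mpullback_inv_mulInvariantVectorField, mpullback_inv_mulInvariantVectorField,
      mpullback_apply, inverse_mfderiv_inv] at h
    refine h.symm.trans ?_
    have h2 (x : E) : -(rightDeriv I (1 : G) 1 (leftDeriv I (1 : G) 1⁻¹ x)) = -x := by
      rw [leftDeriv_one, rightDeriv_one]
      rfl
    refine Eq.trans ?_ (h2 (bracketOne (G := G) (mulInvariantVectorField (I := I) v)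
      (mulInvariantVectorField w)))
    have h3 : ∀ g : G, g = 1 → (mlieBracket I (mulInvariantVectorField v)
        (mulInvariantVectorField w) g : E) =
          bracketOne (mulInvariantVectorField v) (mulInvariantVectorField w) := by
      rintro g rfl; rfl
    exact congrArg (fun x : E => -rightDeriv I (1 : G) 1 (leftDeriv I (1 : G) 1⁻¹ x)) (h3 _ inv_one)
  have h := key (-v) (-w)
  rwa [neg_neg, neg_neg, neg_lie, lie_neg, neg_neg] at h

/-- The derivation of a vector field that vanishes at the identity is its linearization there. -/
lemma linearDerivation_eq_trivDeriv {W : (g : G) → TangentSpace I g}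
    (hW : ContMDiff I I.tangent 1 (fun g : G => (⟨g, W g⟩ : TangentBundle I G)))
    (h1 : W 1 = 0) (z : GroupLieAlgebra I G) : linearDerivation I W z = trivDeriv W z := by
  have h := mlieBracket_eq_trivDeriv hW (rightInvariantVectorField I z)
  have h0 : rightInvariantVectorField I (0 : GroupLieAlgebra I G) = 0 := by
    ext g
    exact map_zero (rightDeriv I g 1)
  have h2 : bracketOne (0 : (g : G) → TangentSpace I g) (rightInvariantVectorField I z) = 0 := by
    unfold bracketOne
    rw [mlieBracket_zero_left]
    rfl
  rw [h1, h0, h2, add_zero, rightInvariantVectorField_one] at h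
  have h3 : linearDerivation I W z = (-bracketOne W (rightInvariantVectorField I z) : E) := rfl
  rw [h3, h, neg_neg]

variable [I.Boundaryless] [T2Space G]

/-- The derivative of the right trivialization along a one-parameter group. -/
lemma hasDerivAt_rightTriv_lieExp {W : (g : G) → TangentSpace I g}
    (hW : ContMDiff I I.tangent 1 (fun g : G => (⟨g, W g⟩ : TangentBundle I G)))
    (v : GroupLieAlgebra I G) :
    HasDerivAt (fun t : ℝ => rightTriv W (lieExp I (t • v))) (trivDeriv W v) 0 := by
  have := FiniteDimensional.complete ℝ E
  have h : HasMFDerivAt I 𝓘(ℝ, E) (rightTriv W) (lieExp I ((0 : ℝ) • v))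
      (trivDeriv W : E →L[ℝ] E) := by
    have h2 : lieExp I ((0 : ℝ) • v) = 1 := by rw [zero_smul, lieExp_zero]
    rw [h2]
    exact hasMFDerivAt_rightTriv hW
  exact hasMFDerivAt_iff_hasFDerivAt.1 ((hasVelocityAt_lieExp_zero v).comp h)

lemma trivDeriv_mulInvariantVectorField_self (v : GroupLieAlgebra I G) :
    trivDeriv (mulInvariantVectorField v) v = 0 := by
  have := FiniteDimensional.complete ℝ E
  refine (hasDerivAt_rightTriv_lieExp (contMDiff_leftInvariantVectorField v) v).unique ?_
  have h (t : ℝ) : rightTriv (mulInvariantVectorField v) (lieExp I (t • v)) = v := by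
    exact (congrArg (rightDeriv I (lieExp I (t • v))⁻¹ (lieExp I (t • v)))
      (leftDeriv_lieExp v t)).trans (rightDeriv_inv_rightDeriv_one (E := E) _ v)
  simp_rw [h]
  exact hasDerivAt_const _ _

/-- The differential of the adjoint representation `Ad` is `ad`: the right trivialization of the
left invariant vector field of `v` is `g ↦ Ad g v`. The map `(z, v) ↦ d(Ad · v)_e z` is
antisymmetric, since `Ad (exp (t v)) v = v`, and its antisymmetrization is given by the brackets
of invariant vector fields. -/
lemma trivDeriv_mulInvariantVectorField (v z : GroupLieAlgebra I G) :
    trivDeriv (mulInvariantVectorField v) z = ⁅z, v⁆ := by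
  have := FiniteDimensional.complete ℝ E
  have := liegroup_minSmoothness (I := I) (G := G)
  let L (v : GroupLieAlgebra I G) : (g : G) → TangentSpace I g := mulInvariantVectorField v
  have hL (v : GroupLieAlgebra I G) := contMDiff_leftInvariantVectorField (I := I) v
  let a (v z : GroupLieAlgebra I G) : E := trivDeriv (L v) z
  have ha (v : GroupLieAlgebra I G) : a v v = 0 := trivDeriv_mulInvariantVectorField_self v
  have hadd : a v z + a z v = 0 := by
    have h := ha (v + z)
    have h1 : trivDeriv (L (v + z)) = trivDeriv (L v) + trivDeriv (L z) := by
      rw [← trivDeriv_add (hL v) (hL z)]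
      exact congrArg trivDeriv (mulInvariantVectorField_add v z)
    have h2 : a (v + z) (v + z) = (a v v + a v z) + (a z v + a z z) := by
      refine (congrArg (fun T : E →L[ℝ] E => T (v + z)) h1).trans ?_
      exact congrArg₂ (fun x y : E => x + y) ((trivDeriv (L v)).map_add v z)
        ((trivDeriv (L z)).map_add v z)
    rw [h2, ha, ha, zero_add, add_zero] at h
    exact h
  have h1 : bracketOne (L v) (L z) = -a v z +
      bracketOne (rightInvariantVectorField I v) (L z) := by
    have := mlieBracket_eq_trivDeriv (hL v) (L z)
    rwa [show L z 1 = z from mulInvariantVectorField_one z,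
      mulInvariantVectorField_one v] at this
  let c : E := (⁅z, v⁆ : GroupLieAlgebra I G)
  have h2 : bracketOne (L z) (rightInvariantVectorField I v) = -a z v + -c := by
    have := mlieBracket_eq_trivDeriv (hL z) (rightInvariantVectorField I v)
    rwa [rightInvariantVectorField_one v, mulInvariantVectorField_one z,
      bracketOne_rightInvariantVectorField] at this
  have h3 : bracketOne (L v) (L z) = -c := (lie_skew v z).symm
  rw [bracketOne_swap (rightInvariantVectorField I v), h2, h3] at h1
  show a v z = c
  have h5 : a z v = -a v z := eq_neg_of_add_eq_zero_right hadd
  rw [h5] at h1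
  have h6 : (2 : ℝ) • a v z = (2 : ℝ) • c := by
    rw [two_smul, two_smul, ← sub_eq_zero]
    have h7 : (-c : E) - (-a v z + -(- -a v z + -c)) = 0 := sub_eq_zero.2 h1
    rw [← h7]
    abel
  exact smul_right_injective E (two_ne_zero (α := ℝ)) h6

end

/-! ### Multiplicative vector fields and cocycles -/

section

variable {E : Type*} [NormedAddCommGroup E] [NormedSpace ℝ E]
  {H : Type*} [TopologicalSpace H] {I : ModelWithCorners ℝ E H}

/-- On a manifold without boundary, a function with zero derivative is locally constant. -/
lemma isLocallyConstant_of_hasMFDerivAt_zero [I.Boundaryless] {M : Type*} [TopologicalSpace M]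
    [ChartedSpace H M] [IsManifold I 1 M] {F : Type*} [NormedAddCommGroup F] [NormedSpace ℝ F]
    {f : M → F} (hf : ∀ x, HasMFDerivAt I 𝓘(ℝ, F) f x (0 : E →L[ℝ] F)) :
    IsLocallyConstant f := by
  rw [IsLocallyConstant.iff_eventually_eq]
  intro x
  have hopen := isOpen_extChartAt_target (I := I) x
  obtain ⟨ε, hε, hball⟩ := Metric.isOpen_iff.1 hopen _ (mem_extChartAt_target (I := I) x)
  have hderiv : ∀ y ∈ Metric.ball (extChartAt I x x) ε,
      HasFDerivAt (f ∘ (extChartAt I x).symm) (0 : E →L[ℝ] F) y := by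
    intro y hy
    have h1 : MDifferentiableAt 𝓘(ℝ, E) I (extChartAt I x).symm y :=
      ((contMDiffOn_extChartAt_symm (n := 1) x).contMDiffAt
        (hopen.mem_nhds (hball hy))).mdifferentiableAt one_ne_zero
    have h2 := HasMFDerivAt.comp y (hf ((extChartAt I x).symm y)) h1.hasMFDerivAt
    refine hasMFDerivAt_iff_hasFDerivAt.1 (h2.congr_mfderiv ?_)
    exact ContinuousLinearMap.zero_comp _
  have hconst : ∀ y ∈ Metric.ball (extChartAt I x x) ε,
      (f ∘ (extChartAt I x).symm) y = (f ∘ (extChartAt I x).symm) (extChartAt I x x) := by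
    intro y hy
    refine Metric.isOpen_ball.is_const_of_fderiv_eq_zero
      (convex_ball (extChartAt I x x) ε).isPreconnected
      (fun z hz => (hderiv z hz).differentiableAt.differentiableWithinAt)
      (fun z hz => (hderiv z hz).fderiv) hy (Metric.mem_ball_self hε)
  filter_upwards [(continuousAt_extChartAt (I := I) x).preimage_mem_nhds
    (Metric.ball_mem_nhds _ hε), extChartAt_source_mem_nhds (I := I) x] with y hy hy'
  have h := hconst _ hy
  rwa [Function.comp_apply, Function.comp_apply, (extChartAt I x).left_inv hy',
    extChartAt_to_inv] at h

variable {G : Type*} [TopologicalSpace G] [ChartedSpace H G] [Group G]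

variable (I) in
/-- The adjoint representation, with values in the endomorphisms of the model space. -/
def adjointMap (g : G) : E →L[ℝ] E := rightDeriv I g⁻¹ g ∘L leftDeriv I g 1

/-- A vector field is multiplicative if its value at a product is given by the product rule. -/
def IsMultiplicative (W : (g : G) → TangentSpace I g) : Prop :=
  ∀ g h : G, (W (g * h) : E) = rightDeriv I h g (W g) + leftDeriv I g h (W h)

namespace IsMultiplicative

variable {W : (g : G) → TangentSpace I g}

lemma map_one (hW : IsMultiplicative W) : W 1 = 0 := by
  have h := hW 1 1
  rw [rightDeriv_one, leftDeriv_one] at h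
  have h1 : ∀ g : G, g = 1 → (W g : E) = W 1 := by rintro g rfl; rfl
  rw [h1 _ (mul_one 1)] at h
  exact left_eq_add.1 h

lemma map_mul_eq_zero (hW : IsMultiplicative W) {g h : G} (hg : W g = 0) (hh : W h = 0) :
    W (g * h) = 0 := by
  have := hW g h
  rw [hg, hh] at this
  refine this.trans ?_
  exact (congrArg₂ (fun x y : E => x + y) (map_zero (rightDeriv I h g))
    (map_zero (leftDeriv I g h))).trans (add_zero _)

end IsMultiplicative

variable [LieGroup I ∞ G]

lemma isMultiplicative_of_isLinearVectorField {W : (g : G) → TangentSpace I g}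
    (hW : IsLinearVectorField I W) : IsMultiplicative W := by
  obtain ⟨-, φ, -, h0, hφ⟩ := hW
  intro g h
  have hv (g : G) : HasVelocityAt I (fun t => φ t g) 0 (W g) := by
    have h1 : HasVelocityAt I (fun t => φ t g) 0 (W (φ 0 g)) := hφ g 0
    rwa [h0] at h1
  have h1 := (hv g).mul (hv h)
  have h2 := hv (g * h)
  simp only [map_mul] at h2
  rw [h2.unique h1, h0, h0]

lemma rightDeriv_mul_inv (g h : G) (v : E) :
    rightDeriv I (g * h)⁻¹ (g * h) (rightDeriv I h g v) = rightDeriv I g⁻¹ g v := by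
  rw [rightDeriv_rightDeriv, mul_inv_rev, mul_inv_cancel_left]

lemma leftDeriv_rightDeriv_one (g h : G) (v : E) :
    leftDeriv I g h (rightDeriv I h 1 v) = rightDeriv I h g (leftDeriv I g 1 v) := by
  have := leftDeriv_rightDeriv (I := I) g h 1 v
  rwa [one_mul, mul_one] at this

lemma adjointMap_mul (g h : G) (v : E) :
    adjointMap I (g * h) v = adjointMap I g (adjointMap I h v) := by
  show rightDeriv I (g * h)⁻¹ (g * h) (leftDeriv I (g * h) 1 v) =
    rightDeriv I g⁻¹ g (leftDeriv I g 1 (rightDeriv I h⁻¹ h (leftDeriv I h 1 v)))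
  rw [← rightDeriv_mul_inv g h (leftDeriv I g 1 _), ← leftDeriv_rightDeriv_one g h,
    rightDeriv_one_rightDeriv_inv]
  have := leftDeriv_leftDeriv (I := I) g h 1 v
  rw [mul_one] at this
  rw [this]

namespace IsMultiplicative

variable {W : (g : G) → TangentSpace I g}

/-- The right trivialization of a multiplicative vector field is a cocycle for the adjoint
representation. -/
lemma rightTriv_mul (hW : IsMultiplicative W) (g h : G) :
    rightTriv W (g * h) = rightTriv W g + adjointMap I g (rightTriv W h) := by
  have h1 : rightTriv W (g * h) = rightDeriv I (g * h)⁻¹ (g * h) (rightDeriv I h g (W g)) +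
      rightDeriv I (g * h)⁻¹ (g * h) (leftDeriv I g h (W h)) := by
    rw [← map_add, ← hW g h]
    rfl
  have h2 : leftDeriv I g h (W h) = rightDeriv I h g (leftDeriv I g 1 (rightTriv W h)) := by
    rw [← leftDeriv_rightDeriv_one]
    exact congrArg (leftDeriv I g h) (rightInvariantVectorField_rightTriv W h).symm
  rw [h1, h2, rightDeriv_mul_inv]
  exact congrArg (fun x : E => x + adjointMap I g (rightTriv W h)) (rightDeriv_mul_inv g h _)

variable [FiniteDimensional ℝ E] [I.Boundaryless] [T2Space G]

/-- A multiplicative vector field whose linearization at the identity kills `z` vanishes along the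
one-parameter group of `z`: by the cocycle property, its right trivialization has derivative zero
there. -/
lemma eq_zero_lieExp (hW : IsMultiplicative W)
    (hs : ContMDiff I I.tangent 1 (fun g : G => (⟨g, W g⟩ : TangentBundle I G)))
    {z : GroupLieAlgebra I G} (hz : trivDeriv W z = 0) (t : ℝ) : W (lieExp I (t • z)) = 0 := by
  have := FiniteDimensional.complete ℝ E
  let f (t : ℝ) : E := rightTriv W (lieExp I (t • z))
  have h0 : HasDerivAt f 0 0 := by
    have := hasDerivAt_rightTriv_lieExp hs z
    rwa [hz] at this
  have hf (s : ℝ) : HasDerivAt f 0 s := by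
    have h1 (t : ℝ) : f t = f s + adjointMap I (lieExp I (s • z)) (f (t - s)) := by
      show rightTriv W _ = rightTriv W _ + _
      rw [← hW.rightTriv_mul, ← lieExp_add_smul, add_sub_cancel]
    have h2 : HasDerivAt (fun t => f (t - s)) 0 s := by
      have h3 : HasDerivAt f 0 (s - s) := by rwa [sub_self]
      simpa using! HasDerivAt.scomp (h := fun t => t - s) s h3 ((hasDerivAt_id s).sub_const s)
    have h3 := ((adjointMap I (lieExp I (s • z))).hasFDerivAt.comp_hasDerivAt s h2).const_add (f s)
    rw [_root_.map_zero] at h3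
    exact h3.congr_of_eventuallyEq (Eventually.of_forall h1)
  have hconst : f t = f 0 := is_const_of_deriv_eq_zero (fun s => (hf s).differentiableAt)
    (fun s => (hf s).deriv) t 0
  have h00 : f 0 = 0 := by
    show rightTriv W (lieExp I ((0 : ℝ) • z)) = 0
    rw [zero_smul, lieExp_zero, rightTriv_one]
    exact hW.map_one
  rw [← rightInvariantVectorField_rightTriv W (lieExp I (t • z))]
  show rightDeriv I _ _ (f t) = 0
  rw [hconst, h00, _root_.map_zero]

end IsMultiplicative

/-- On a connected group, a cocycle for the adjoint representation is determined by its
derivative at the identity. -/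
lemma cocycle_eq_zero [I.Boundaryless] [ConnectedSpace G] {w : G → E}
    (hmul : ∀ g h, w (g * h) = w g + adjointMap I g (w h))
    (hd : HasMFDerivAt I 𝓘(ℝ, E) w 1 (0 : E →L[ℝ] E)) (g : G) : w g = 0 := by
  have hd' (g : G) : HasMFDerivAt I 𝓘(ℝ, E) w g (0 : E →L[ℝ] E) := by
    have h1 (x : G) : w x = w g + adjointMap I g (w (g⁻¹ * x)) := by
      rw [← hmul, mul_inv_cancel_left]
    have h2 : HasMFDerivAt I 𝓘(ℝ, E) w (g⁻¹ * g) (0 : E →L[ℝ] E) := by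
      rwa [inv_mul_cancel]
    have h3 := HasMFDerivAt.comp g h2 (hasMFDerivAt_mul_left g⁻¹ g)
    have h4 := HasMFDerivAt.comp g (adjointMap I g).hasMFDerivAt h3
    have h5 := (hasMFDerivAt_const (I := I) (I' := 𝓘(ℝ, E)) (w g) g).add h4
    refine (h5.congr_mfderiv ?_).congr_of_eventuallyEq (Eventually.of_forall h1)
    refine ContinuousLinearMap.ext fun v : E => ?_
    show (0 : E) + adjointMap I g 0 = 0
    rw [map_zero, add_zero]
  have h1 : w 1 = 0 := by
    have := hmul 1 1
    have h2 : adjointMap I (1 : G) (w 1) = w 1 := by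
      show rightDeriv I 1⁻¹ 1 (leftDeriv I 1 1 (w 1)) = w 1
      rw [inv_one, leftDeriv_one, rightDeriv_one]
      rfl
    rw [mul_one, h2] at this
    exact left_eq_add.1 this
  have : IsManifold I 1 G := IsManifold.of_le (n := ∞) (by norm_cast)
  rw [← h1]
  exact (isLocallyConstant_of_hasMFDerivAt_zero hd').apply_eq_of_preconnectedSpace g 1

/-- A linear vector field with inner derivation `ad x` is the difference of the right and the left
invariant vector fields of `x`. -/
lemma isLinearVectorField_eq_sub [FiniteDimensional ℝ E] [I.Boundaryless] [T2Space G]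
    [ConnectedSpace G] {W : (g : G) → TangentSpace I g} (hW : IsLinearVectorField I W)
    {x : GroupLieAlgebra I G} (hx : ∀ z, linearDerivation I W z = ⁅x, z⁆) (g : G) :
    W g = rightInvariantVectorField I x g - mulInvariantVectorField x g := by
  have := FiniteDimensional.complete ℝ E
  have := liegroup_minSmoothness (I := I) (G := G)
  have hm := isMultiplicative_of_isLinearVectorField hW
  have hs := hW.1.of_le (m := 1) (by norm_cast)
  let e : E := x
  let w (g : G) : E := rightTriv W g + adjointMap I g e - e
  have hmul (g h : G) : w (g * h) = w g + adjointMap I g (w h) := by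
    show rightTriv W (g * h) + adjointMap I (g * h) e - e =
      rightTriv W g + adjointMap I g e - e +
        adjointMap I g (rightTriv W h + adjointMap I h e - e : E)
    rw [hm.rightTriv_mul]
    have h1 := adjointMap_mul (I := I) g h e
    rw [h1, map_sub, map_add]
    abel
  have hd : HasMFDerivAt I 𝓘(ℝ, E) w 1 (0 : E →L[ℝ] E) := by
    have h1 := (hasMFDerivAt_rightTriv hs).add
      (hasMFDerivAt_rightTriv (contMDiff_leftInvariantVectorField x))
    have h2 := h1.sub (hasMFDerivAt_const (I := I) (I' := 𝓘(ℝ, E)) e (1 : G))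
    refine h2.congr_mfderiv ?_
    refine ContinuousLinearMap.ext fun y : E => ?_
    let z : GroupLieAlgebra I G := y
    have h3 : trivDeriv W z = ⁅x, z⁆ :=
      (linearDerivation_eq_trivDeriv hs hm.map_one z).symm.trans (hx z)
    have h4 := trivDeriv_mulInvariantVectorField x z
    have h5 : ⁅x, z⁆ + ⁅z, x⁆ = 0 := by rw [← lie_skew, neg_add_cancel]
    exact (sub_zero (G := E) _).trans ((congrArg₂ (fun a b : E => a + b) h3 h4).trans h5)
  have h := cocycle_eq_zero hmul hd g
  have h1 : rightTriv W g = e - adjointMap I g e := by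
    have h2 : rightTriv W g + adjointMap I g e - e = 0 := h
    rw [sub_eq_zero] at h2
    exact eq_sub_of_add_eq h2
  rw [← rightInvariantVectorField_rightTriv W g, h1]
  show rightDeriv I g 1 (e - adjointMap I g e : E) = rightDeriv I g 1 e - leftDeriv I g 1 e
  have h5 : rightDeriv I g 1 (adjointMap I g e) = leftDeriv I g 1 e :=
    rightDeriv_one_rightDeriv_inv (E := E) g _
  rw [map_sub, h5]

end

/-! ### Concatenation of piecewise constant controls and of solutions -/

section

lemma continuousOn_ite_Icc {X : Type*} [TopologicalSpace X] {f g : ℝ → X} {a d b : ℝ}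
    (had : a ≤ d) (hdb : d ≤ b) (hf : ContinuousOn f (Icc a d)) (hg : ContinuousOn g (Icc d b))
    (h : f d = g d) : ContinuousOn (fun t => if t ≤ d then f t else g t) (Icc a b) := by
  rw [← Icc_union_Icc_eq_Icc had hdb]
  refine ContinuousOn.union_of_isClosed (hf.congr fun t ht => if_pos ht.2)
    (hg.congr fun t ht => ?_) isClosed_Icc isClosed_Icc
  rcases ht.1.eq_or_lt with rfl | h'
  · simp [h]
  · exact if_neg h'.not_ge

lemma isPiecewiseConstant_concat {α : Type*} {u v : ℝ → α} (hu : IsPiecewiseConstant u)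
    (hv : IsPiecewiseConstant v) (d : ℝ) :
    IsPiecewiseConstant (fun t => if t ≤ d then u t else v (t - d)) := by
  intro a b
  obtain ⟨D, hD, hu⟩ := hu a b
  obtain ⟨D', hD', hv⟩ := hv (a - d) (b - d)
  refine ⟨D ∪ (fun t => t + d) '' D' ∪ {d}, (hD.union (hD'.image _)).union (finite_singleton d),
    fun s hs => ?_⟩
  simp only [Set.mem_sdiff, mem_union, mem_singleton_iff, not_or] at hs
  obtain ⟨hs, ⟨hsD, hsD'⟩, hsd⟩ := hs
  rcases lt_or_gt_of_ne hsd with h | h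
  · filter_upwards [hu s ⟨hs, hsD⟩, eventually_lt_nhds h] with r hr hrd
    rw [if_pos hrd.le, if_pos h.le, hr]
  · have h1 : s - d ∈ Icc (a - d) (b - d) \ D' :=
      ⟨⟨by linarith [hs.1], by linarith [hs.2]⟩, fun h' => hsD' ⟨s - d, h', by simp⟩⟩
    have h2 : Tendsto (fun t => t - d) (𝓝 s) (𝓝 (s - d)) :=
      (continuous_id.sub continuous_const).tendsto s
    filter_upwards [h2.eventually (hv _ h1), eventually_gt_nhds h] with r hr hrd
    rw [if_neg (not_le.2 hrd), if_neg (not_le.2 h), hr]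

/-- A function that is locally constant on an open interval is constant there. -/
lemma exists_eq_const_of_locally_eq {α : Type*} {u : ℝ → α} {a b : ℝ} (hab : a < b)
    (hu : ∀ s ∈ Ioo a b, ∀ᶠ r in 𝓝 s, u r = u s) : ∀ s ∈ Ioo a b, u s = u ((a + b) / 2) := by
  have : PreconnectedSpace (Ioo a b) := Subtype.preconnectedSpace isPreconnected_Ioo
  have hloc : IsLocallyConstant (fun s : Ioo a b => u s) := by
    rw [IsLocallyConstant.iff_eventually_eq]
    exact fun s => continuousAt_subtype_val.eventually (hu s s.2)
  intro s hs
  exact hloc.apply_eq_of_preconnectedSpace ⟨s, hs⟩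
    ⟨(a + b) / 2, by constructor <;> linarith⟩

variable {E : Type*} [NormedAddCommGroup E] [NormedSpace ℝ E]
  {H : Type*} [TopologicalSpace H] {I : ModelWithCorners ℝ E H}
  {G : Type*} [TopologicalSpace G] [ChartedSpace H G] {m : ℕ}

/-- Velocities of a curve that follows `γ` up to time `d` and then `δ`. -/
lemma hasVelocityAt_ite {γ δ : ℝ → G} {d s : ℝ} {v : E}
    (h1 : s < d → HasVelocityAt I γ s v) (h2 : d < s → HasVelocityAt I δ s v) (hsd : s ≠ d) :
    HasVelocityAt I (fun t => if t ≤ d then γ t else δ t) s v := by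
  rcases lt_or_gt_of_ne hsd with h | h
  · refine (h1 h).congr ?_
    filter_upwards [eventually_lt_nhds h] with t ht
    exact if_pos ht.le
  · refine (h2 h).congr ?_
    filter_upwards [eventually_gt_nhds h] with t ht
    exact if_neg (not_le.2 ht)

lemma HasVelocityAt.comp_sub_const {γ : ℝ → G} {s d : ℝ} {v : E}
    (h : HasVelocityAt I γ (s - d) v) : HasVelocityAt I (fun t => γ (t - d)) s v := by
  have h' := h.scomp (a := fun t => t - d) ((hasDerivAt_id s).sub_const d)
  rwa [one_smul] at h'

lemma reachableSet_trans {V : Fin (m + 1) → (g : G) → TangentSpace I g} {U : Set (Fin m → ℝ)}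
    {g h k : G} (h1 : h ∈ reachableSet I V U g) (h2 : k ∈ reachableSet I V U h) :
    k ∈ reachableSet I V U g := by
  simp only [reachableSet, mem_iUnion, exists_prop] at *
  obtain ⟨T, hT, u, hu, γ, ⟨hγc, D, hD, hγ⟩, hγ0, hγT⟩ := h1
  obtain ⟨S, hS, v, hv, δ, ⟨hδc, D', hD', hδ⟩, hδ0, hδS⟩ := h2
  have hδc' : ContinuousOn (fun t => δ (t - T)) (Icc T (T + S)) :=
    hδc.comp (continuous_id.sub continuous_const).continuousOn
      fun t ht => ⟨by simpa using ht.1, by simpa [add_comm] using ht.2⟩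
  refine ⟨T + S, by positivity, fun t => if t ≤ T then u t else v (t - T),
    ⟨fun t => ?_, isPiecewiseConstant_concat hu.2 hv.2 T⟩,
    fun t => if t ≤ T then γ t else δ (t - T),
    ⟨continuousOn_ite_Icc hT.le (by linarith) hγc hδc' (by simp [hγT, hδ0]),
      D ∪ (fun t => t + T) '' D' ∪ {T},
      (hD.union (hD'.image _)).union (finite_singleton T), fun s hs => ?_⟩, ?_, ?_⟩
  · dsimp only
    split_ifs
    exacts [hu.1 _, hv.1 _]
  · simp only [Set.mem_sdiff, mem_union, mem_singleton_iff, not_or] at hs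
    obtain ⟨hs, ⟨hsD, hsD'⟩, hsT⟩ := hs
    refine hasVelocityAt_ite (fun h => ?_) (fun h => ?_) hsT
    · exact (congrArg₂ (fun x y => HasVelocityAt I γ s (controlField I V x y))
        (if_pos h.le) (if_pos h.le)).mpr (hγ s ⟨⟨hs.1, h⟩, hsD⟩)
    · refine (congrArg₂ (fun x y => HasVelocityAt I (fun t => δ (t - T)) s (controlField I V x y))
        (if_neg h.not_ge) (if_neg h.not_ge)).mpr ?_
      have h3 : HasVelocityAt I δ (s - T) (controlField I V (v (s - T)) (δ (s - T))) :=
        hδ (s - T) ⟨⟨by linarith, by linarith [hs.2]⟩, fun h' => hsD' ⟨s - T, h', by simp⟩⟩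
      exact h3.comp_sub_const
  · simp [hT.le, hγ0]
  · simp [hS, hδS]

end

/-! ### Solutions of the affine and of the invariant system -/

section

variable {E : Type*} [NormedAddCommGroup E] [NormedSpace ℝ E]
  {H : Type*} [TopologicalSpace H] {I : ModelWithCorners ℝ E H}
  {G : Type*} [TopologicalSpace G] [ChartedSpace H G] [Group G] {m : ℕ}

/-- The combination `a₀ + ∑ⱼ uⱼ aⱼ` for the control value `u`. -/
def controlSum {F : Type*} [AddCommGroup F] [Module ℝ F] (a : Fin (m + 1) → F) (u : Fin m → ℝ) :
    F :=
  a 0 + ∑ j, u j • a j.succ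

lemma map_controlSum {F F' : Type*} [AddCommGroup F] [Module ℝ F] [AddCommGroup F'] [Module ℝ F']
    (L : F →ₗ[ℝ] F') (a : Fin (m + 1) → F) (u : Fin m → ℝ) :
    L (controlSum a u) = controlSum (fun i => L (a i)) u := by
  simp [controlSum]

lemma controlSum_add {F : Type*} [AddCommGroup F] [Module ℝ F] (a b : Fin (m + 1) → F)
    (u : Fin m → ℝ) : controlSum (fun i => a i + b i) u = controlSum a u + controlSum b u := by
  simp only [controlSum, smul_add, Finset.sum_add_distrib]
  abel

lemma controlField_invariantFields (X Y : Fin (m + 1) → GroupLieAlgebra I G) (u : Fin m → ℝ)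
    (g : G) : controlField I (invariantFields I X Y) u g =
      (rightDeriv I g 1 (controlSum (F := E) X u + controlSum (F := E) Y u) : E) := by
  refine Eq.trans ?_ (congrArg (rightDeriv I g 1) (controlSum_add (F := E) X Y u))
  exact (map_controlSum (F := E) (F' := E) (rightDeriv I g 1).toLinearMap
    (fun i => (X i + Y i : E)) u).symm

lemma controlField_affineFields {𝒳 : Fin (m + 1) → (g : G) → TangentSpace I g}
    {X : Fin (m + 1) → GroupLieAlgebra I G}
    (h : ∀ i g, 𝒳 i g = rightInvariantVectorField I (X i) g - mulInvariantVectorField (X i) g)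
    (Y : Fin (m + 1) → GroupLieAlgebra I G) (u : Fin m → ℝ) (g : G) :
    controlField I (affineFields I 𝒳 Y) u g =
      (rightDeriv I g 1 (controlSum (F := E) X u + controlSum (F := E) Y u) -
        leftDeriv I g 1 (controlSum (F := E) X u) : E) := by
  have h1 : rightDeriv I g 1 (controlSum (F := E) X u + controlSum (F := E) Y u) -
      leftDeriv I g 1 (controlSum (F := E) X u) =
        (rightDeriv I g 1 - leftDeriv I g 1) (controlSum (F := E) X u) +
          rightDeriv I g 1 (controlSum (F := E) Y u) := by
    rw [map_add]
    show _ = (rightDeriv I g 1 _ - leftDeriv I g 1 _) + _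
    abel
  rw [h1]
  have h2 := map_controlSum (F := E) (F' := E) (rightDeriv I g 1 - leftDeriv I g 1).toLinearMap X u
  have h3 := map_controlSum (F := E) (F' := E) (rightDeriv I g 1).toLinearMap Y u
  refine Eq.trans ?_ (congrArg₂ (fun x y : E => x + y) h2 h3).symm
  refine Eq.trans ?_ (controlSum_add (F := E) _ _ u)
  exact congrArg (fun a : Fin (m + 1) → E => controlSum a u) (funext fun i =>
    congrArg (fun x : E => x + rightDeriv I g 1 (Y i)) (h i g))

variable [LieGroup I ∞ G]

/-- Right translation by a common zero of the multiplicative fields `𝒳ᵢ` maps solutions of the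
affine system to solutions. -/
lemma mul_mem_reachableSet {𝒳 : Fin (m + 1) → (g : G) → TangentSpace I g}
    (h𝒳 : ∀ i, IsMultiplicative (𝒳 i)) (Y : Fin (m + 1) → GroupLieAlgebra I G)
    {U : Set (Fin m → ℝ)} {g h q : G} (hq : ∀ i, 𝒳 i q = 0)
    (hgh : h ∈ reachableSet I (affineFields I 𝒳 Y) U g) :
    h * q ∈ reachableSet I (affineFields I 𝒳 Y) U (g * q) := by
  have hfield (u : Fin m → ℝ) (x : G) : rightDeriv I q x (controlField I (affineFields I 𝒳 Y) u x) =
      controlField I (affineFields I 𝒳 Y) u (x * q) := by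
    refine (map_controlSum (F := E) (F' := E) (rightDeriv I q x).toLinearMap
      (fun i => affineFields I 𝒳 Y i x) u).trans ?_
    refine Eq.trans (b := controlSum (F := E) (fun i => affineFields I 𝒳 Y i (x * q)) u) ?_ rfl
    refine congrArg (fun a : Fin (m + 1) → E => controlSum a u) (funext fun i => ?_)
    have h1 : (𝒳 i (x * q) : E) = rightDeriv I q x (𝒳 i x) := by
      refine (h𝒳 i x q).trans ?_
      rw [hq i]
      exact (congrArg (fun y : E => rightDeriv I q x (𝒳 i x) + y)
        (map_zero (leftDeriv I x q))).trans (add_zero _)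
    refine (ContinuousLinearMap.map_add (M₁ := E) (M₂ := E) (rightDeriv I q x) _ _).trans ?_
    exact congrArg₂ (fun y z : E => y + z) h1.symm (rightDeriv_rightInvariantVectorField (Y i) q x)
  simp only [reachableSet, mem_iUnion, exists_prop] at *
  obtain ⟨T, hT, u, hu, γ, ⟨hγc, D, hD, hγ⟩, rfl, rfl⟩ := hgh
  have hcont : Continuous fun x : G => x * q :=
    (contMDiff_mul_right (I := I) (n := ∞)).continuous
  refine ⟨T, hT, u, hu, fun t => γ t * q, ⟨hcont.comp_continuousOn hγc, D, hD, fun s hs => ?_⟩,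
    rfl, rfl⟩
  have h1 : HasVelocityAt I γ s (controlField I (affineFields I 𝒳 Y) (u s) (γ s)) := hγ s hs
  have h2 := h1.mul_const q
  exact (congrArg (HasVelocityAt I (fun t => γ t * q) s) (hfield (u s) (γ s))).mp h2

/-- The curve `p` solves `dp/ds = (X_{u(s)})^R (p)` on `[a, b]`, off a finite set, with
`p a = 1`. -/
def IsDrift (X : Fin (m + 1) → GroupLieAlgebra I G) (u : ℝ → Fin m → ℝ) (p : ℝ → G) (a b : ℝ) :
    Prop :=
  p a = 1 ∧ ContinuousOn p (Icc a b) ∧ ∃ D : Set ℝ, D.Finite ∧ ∀ s ∈ Ioo a b \ D,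
    HasVelocityAt I p s (rightDeriv I (p s) 1 (controlSum (F := E) X (u s)))

/-- If the linear fields are `Xᵢ^R - Xᵢ^L`, then a solution `γ` of the invariant system gives the
solutions `γ g p⁻¹` of the affine one, for the same control. -/
lemma mul_inv_mem_reachableSet {𝒳 : Fin (m + 1) → (g : G) → TangentSpace I g}
    {X : Fin (m + 1) → GroupLieAlgebra I G}
    (h : ∀ i g, 𝒳 i g = rightInvariantVectorField I (X i) g - mulInvariantVectorField (X i) g)
    (Y : Fin (m + 1) → GroupLieAlgebra I G) {U : Set (Fin m → ℝ)} {u : ℝ → Fin m → ℝ}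
    (hu : IsAdmissibleControl U u) {γ p : ℝ → G} {T : ℝ} (hT : 0 < T)
    (hγ : IsSolutionOn I (invariantFields I X Y) u γ T) (hγ0 : γ 0 = 1)
    (hp : IsDrift X u p 0 T) (g : G) :
    γ T * (g * (p T)⁻¹) ∈ reachableSet I (affineFields I 𝒳 Y) U g := by
  have := topologicalGroup_of_lieGroup I ∞ (G := G)
  obtain ⟨hγc, D, hD, hγ⟩ := hγ
  obtain ⟨hp0, hpc, D', hD', hp⟩ := hp
  simp only [reachableSet, mem_iUnion, exists_prop]
  refine ⟨T, hT, u, hu, fun t => γ t * (g * (p t)⁻¹),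
    ⟨hγc.mul (continuousOn_const.mul hpc.inv), D ∪ D', hD.union hD', fun s hs => ?_⟩, ?_, rfl⟩
  · have h1 : HasVelocityAt I γ s (controlField I (invariantFields I X Y) (u s) (γ s)) :=
      hγ s ⟨hs.1, fun h => hs.2 (Or.inl h)⟩
    have h2 := (hp s ⟨hs.1, fun h => hs.2 (Or.inr h)⟩).inv.const_mul g
    rw [rightDeriv_inv_rightDeriv_one] at h2
    rw [controlField_invariantFields] at h1
    have h3 := h1.mul h2
    show HasVelocityAt I _ s (controlField I (affineFields I 𝒳 Y) (u s) (γ s * (g * (p s)⁻¹)))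
    rw [controlField_affineFields h]
    convert! h3 using 1
    have h4 (v : E) : leftDeriv I (γ s) (g * (p s)⁻¹) (leftDeriv I g (p s)⁻¹
        (-leftDeriv I (p s)⁻¹ 1 v)) = -leftDeriv I (γ s * (g * (p s)⁻¹)) 1 v := by
      rw [map_neg, map_neg]
      have h5 := leftDeriv_leftDeriv (I := I) g (p s)⁻¹ 1 v
      have h6 := leftDeriv_leftDeriv (I := I) (γ s) (g * (p s)⁻¹) 1 v
      rw [mul_one] at h5 h6
      rw [h5, h6]
    have h5 (v : E) : rightDeriv I (g * (p s)⁻¹) (γ s) (rightDeriv I (γ s) 1 v) =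
        rightDeriv I (γ s * (g * (p s)⁻¹)) 1 v := by
      have := rightDeriv_rightDeriv (I := I) (g * (p s)⁻¹) (γ s) 1 v
      rwa [one_mul] at this
    rw [h4, h5, sub_eq_add_neg]
  · simp [hγ0, hp0]

lemma IsDrift.concat {X : Fin (m + 1) → GroupLieAlgebra I G} {u : ℝ → Fin m → ℝ} {p q : ℝ → G}
    {a d b : ℝ} (had : a ≤ d) (hdb : d ≤ b) (hp : IsDrift X u p a d) (hq : IsDrift X u q d b) :
    IsDrift X u (fun t => if t ≤ d then p t else q t * p d) a b := by
  obtain ⟨hp0, hpc, D, hD, hp⟩ := hp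
  obtain ⟨hq0, hqc, D', hD', hq⟩ := hq
  have hcont : Continuous fun x : G => x * p d :=
    (contMDiff_mul_right (I := I) (n := ∞)).continuous
  refine ⟨by simp [had, hp0], continuousOn_ite_Icc had hdb hpc (hcont.comp_continuousOn hqc)
    (by simp [hq0]), D ∪ D' ∪ {d}, (hD.union hD').union (finite_singleton d), fun s hs => ?_⟩
  simp only [Set.mem_sdiff, mem_union, mem_singleton_iff, not_or] at hs
  obtain ⟨hs, ⟨hsD, hsD'⟩, hsd⟩ := hs
  refine hasVelocityAt_ite (fun h => ?_) (fun h => ?_) hsd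
  · refine (congrArg (fun y => HasVelocityAt I p s
      (rightDeriv I y 1 (controlSum (F := E) X (u s)))) (if_pos h.le)).mpr ?_
    exact hp s ⟨⟨hs.1, h⟩, hsD⟩
  · refine (congrArg (fun y => HasVelocityAt I (fun t => q t * p d) s
      (rightDeriv I y 1 (controlSum (F := E) X (u s)))) (if_neg h.not_ge)).mpr ?_
    exact (hq s ⟨⟨h, hs.2⟩, hsD'⟩).mul_const_rightInvariant (p d)

variable [CompleteSpace E] [I.Boundaryless] [T2Space G]

/-- For a piecewise constant control with values in `U`, the drift exists, and it is a product of
exponentials of the vectors `X_u`, `u ∈ U`. -/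
lemma exists_isDrift {X : Fin (m + 1) → GroupLieAlgebra I G} {u : ℝ → Fin m → ℝ}
    {U : Set (Fin m → ℝ)} (hu : ∀ s, u s ∈ U) (N : Subgroup G)
    (hN : ∀ v ∈ U, ∀ t : ℝ, lieExp I (t • controlSum X v) ∈ N) {D : Set ℝ} (hD : D.Finite)
    {a b : ℝ} (hab : a < b) (hloc : ∀ s ∈ Ioo a b \ D, ∀ᶠ r in 𝓝 s, u r = u s) :
    ∃ p : ℝ → G, IsDrift X u p a b ∧ p b ∈ N := by
  induction h : (D ∩ Ioo a b).ncard using Nat.strong_induction_on generalizing a b with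
  | _ n ih =>
    subst h
    have hfin : (D ∩ Ioo a b).Finite := hD.subset inter_subset_left
    by_cases hne : (D ∩ Ioo a b).Nonempty
    · obtain ⟨d, hdD, hd⟩ := hne
      have h1 : (D ∩ Ioo a d).ncard < (D ∩ Ioo a b).ncard :=
        ncard_lt_ncard ⟨inter_subset_inter_right _ (Ioo_subset_Ioo_right hd.2.le),
          fun h => lt_irrefl d (h ⟨hdD, hd⟩).2.2⟩ hfin
      have h2 : (D ∩ Ioo d b).ncard < (D ∩ Ioo a b).ncard :=
        ncard_lt_ncard ⟨inter_subset_inter_right _ (Ioo_subset_Ioo_left hd.1.le),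
          fun h => lt_irrefl d (h ⟨hdD, hd⟩).2.1⟩ hfin
      obtain ⟨p, hp, hpN⟩ := ih _ h1 hd.1
        (fun s hs => hloc s ⟨⟨hs.1.1, hs.1.2.trans hd.2⟩, hs.2⟩) rfl
      obtain ⟨q, hq, hqN⟩ := ih _ h2 hd.2
        (fun s hs => hloc s ⟨⟨hd.1.trans hs.1.1, hs.1.2⟩, hs.2⟩) rfl
      refine ⟨_, hp.concat hd.1.le hd.2.le hq, ?_⟩
      rw [if_neg hd.2.not_ge]
      exact N.mul_mem hqN hpN
    · have hconst := exists_eq_const_of_locally_eq hab fun s hs =>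
        hloc s ⟨hs, fun h => hne ⟨s, h, hs⟩⟩
      let x : GroupLieAlgebra I G := controlSum X (u ((a + b) / 2))
      have hvel (s : ℝ) : HasVelocityAt I (fun t : ℝ => lieExp I ((t - a) • x)) s
          (rightDeriv I (lieExp I ((s - a) • x)) 1 x) :=
        HasVelocityAt.comp_sub_const (hasVelocityAt_lieExp x (s - a))
      refine ⟨fun t => lieExp I ((t - a) • x), ⟨by simp [lieExp_zero], fun s _ =>
        (HasMFDerivAt.continuousAt (hvel s)).continuousWithinAt, ∅, finite_empty, fun s hs => ?_⟩,
        hN _ (hu _) _⟩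
      rw [hconst s hs.1]
      exact hvel s

end

/-! ### Controllability -/

section

variable {E : Type*} [NormedAddCommGroup E] [NormedSpace ℝ E] [FiniteDimensional ℝ E]
  {H : Type*} [TopologicalSpace H] {I : ModelWithCorners ℝ E H} [I.Boundaryless]
  {G : Type*} [TopologicalSpace G] [ChartedSpace H G] [Group G] [LieGroup I ∞ G] [T2Space G]
  {m : ℕ}

/-- The one-parameter groups of the vectors `X_u` consist of zeros of all linear fields, as the
`Xᵢ` commute. -/
lemma linearVectorField_lieExp_controlSum_eq_zero {𝒳 : Fin (m + 1) → (g : G) → TangentSpace I g}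
    (h𝒳 : ∀ i, IsLinearVectorField I (𝒳 i)) {X : Fin (m + 1) → GroupLieAlgebra I G}
    (hinner : ∀ i, ∀ Z : GroupLieAlgebra I G, linearDerivation I (𝒳 i) Z = ⁅X i, Z⁆)
    (hcomm : ∀ i j, ⁅X i, X j⁆ = 0) (u : Fin m → ℝ) (t : ℝ) (i : Fin (m + 1)) :
    𝒳 i (lieExp I (t • controlSum X u)) = 0 := by
  have := FiniteDimensional.complete ℝ E
  have := liegroup_minSmoothness (I := I) (G := G)
  have hm := isMultiplicative_of_isLinearVectorField (h𝒳 i)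
  have hs := (h𝒳 i).1.of_le (m := 1) (by norm_cast)
  refine hm.eq_zero_lieExp hs ?_ t
  have h1 : ⁅X i, controlSum X u⁆ = 0 := by
    simp [controlSum, lie_sum, hcomm]
  exact (linearDerivation_eq_trivDeriv hs hm.map_one _).symm.trans ((hinner i _).trans h1)

/-- A point reachable from the identity by the invariant system is, up to a right factor in `N`,
reachable by the affine system, from any starting point. -/
lemma exists_mul_inv_mem_reachableSet {𝒳 : Fin (m + 1) → (g : G) → TangentSpace I g}
    {X : Fin (m + 1) → GroupLieAlgebra I G}
    (h : ∀ i g, 𝒳 i g = rightInvariantVectorField I (X i) g - mulInvariantVectorField (X i) g)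
    (Y : Fin (m + 1) → GroupLieAlgebra I G) {U : Set (Fin m → ℝ)} (N : Subgroup G)
    (hN : ∀ v ∈ U, ∀ t : ℝ, lieExp I (t • controlSum X v) ∈ N) {k : G}
    (hk : k ∈ reachableSet I (invariantFields I X Y) U 1) :
    ∃ p ∈ N, ∀ g, k * (g * p⁻¹) ∈ reachableSet I (affineFields I 𝒳 Y) U g := by
  have := FiniteDimensional.complete ℝ E
  simp only [reachableSet, mem_iUnion, exists_prop] at hk
  obtain ⟨T, hT, u, hu, γ, hγ, hγ0, rfl⟩ := hk
  obtain ⟨D, hD, hloc⟩ := hu.2 0 T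
  obtain ⟨p, hp, hpN⟩ := exists_isDrift (I := I) (X := X) hu.1 N hN hD hT
    fun s hs => hloc s ⟨Ioo_subset_Icc_self hs.1, hs.2⟩
  exact ⟨p T, hpN, mul_inv_mem_reachableSet h Y hu hT hγ hγ0 hp⟩

end

end AffineControl

end

open AffineControl

theorem theorem3p3
    {E : Type*} [NormedAddCommGroup E] [NormedSpace ℝ E] [FiniteDimensional ℝ E]
    {H : Type*} [TopologicalSpace H] (I : ModelWithCorners ℝ E H) [I.Boundaryless]
    {G : Type*} [TopologicalSpace G] [ChartedSpace H G] [Group G] [LieGroup I ∞ G]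
    [T2Space G] [ConnectedSpace G]
    {m : ℕ} (U : Set (Fin m → ℝ))
    (𝒳 : Fin (m + 1) → (g : G) → TangentSpace I g)
    (h𝒳 : ∀ i, IsLinearVectorField I (𝒳 i))
    (X Y : Fin (m + 1) → GroupLieAlgebra I G)
    (hinner : ∀ i, ∀ Z : GroupLieAlgebra I G, linearDerivation I (𝒳 i) Z = ⁅X i, Z⁆)
    (hcomm : ∀ i j, ⁅X i, X j⁆ = 0)
    (hI : IsControllable I (invariantFields I X Y) U) :
    (∀ u ∈ U, ∀ t : ℝ,
        lieExp I (t • (X 0 + ∑ j, u j • X j.succ)) ∈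
          reachableSet I (affineFields I 𝒳 Y) U (1 : G)) ↔
      IsControllable I (affineFields I 𝒳 Y) U := by
  refine ⟨fun hexp => ?_, fun h u _ t => h 1 ▸ mem_univ _⟩
  have := FiniteDimensional.complete ℝ E
  have hm i := isMultiplicative_of_isLinearVectorField (h𝒳 i)
  have h𝒳X i g := isLinearVectorField_eq_sub (h𝒳 i) (hinner i) g
  have hzero := linearVectorField_lieExp_controlSum_eq_zero h𝒳 hinner hcomm
  set A := reachableSet I (affineFields I 𝒳 Y) U
  obtain ⟨v, hv⟩ : U.Nonempty := by
    have h1 : (1 : G) ∈ reachableSet I (invariantFields I X Y) U 1 := hI 1 ▸ mem_univ _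
    simp only [reachableSet, mem_iUnion] at h1
    obtain ⟨-, -, u, hu, -⟩ := h1
    exact ⟨u 0, hu.1 0⟩
  have h1A : (1 : G) ∈ A 1 := by simpa [lieExp_zero] using hexp v hv 0
  -- Common zeros of the linear fields act by right translation on solutions, so that those in
  -- the reachable set form a semigroup.
  have hmulA {p q : G} (hp : p ∈ A 1) (hq : q ∈ A 1) (hq0 : ∀ i, 𝒳 i q = 0) : p * q ∈ A 1 := by
    have := mul_mem_reachableSet hm Y hq0 hp
    rw [one_mul] at this
    exact reachableSet_trans hq this
  let N : Subgroup G :=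
    { carrier := {q | (q ∈ A 1 ∧ ∀ i, 𝒳 i q = 0) ∧ q⁻¹ ∈ A 1 ∧ ∀ i, 𝒳 i q⁻¹ = 0}
      one_mem' := by
        have h1 i := (hm i).map_one
        rw [mem_ofPred_eq, inv_one]
        exact ⟨⟨h1A, h1⟩, h1A, h1⟩
      mul_mem' := by
        rintro p q ⟨⟨hp, hp0⟩, hp', hp0'⟩ ⟨⟨hq, hq0⟩, hq', hq0'⟩
        rw [mem_ofPred_eq, mul_inv_rev]
        exact ⟨⟨hmulA hp hq hq0, fun i => (hm i).map_mul_eq_zero (hp0 i) (hq0 i)⟩,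
          hmulA hq' hp' hp0', fun i => (hm i).map_mul_eq_zero (hq0' i) (hp0' i)⟩
      inv_mem' := by
        rintro p ⟨hp, hp'⟩
        exact ⟨hp', by rwa [inv_inv]⟩ }
  have hN : ∀ v ∈ U, ∀ t : ℝ, lieExp I (t • controlSum X v) ∈ N := by
    intro v hv t
    refine ⟨⟨hexp v hv t, hzero v t⟩, ?_⟩
    rw [← lieExp_neg_smul]
    exact ⟨hexp v hv (-t), hzero v (-t)⟩
  have hreach {p q : G} (hp : p ∈ N) (hq : q ∈ N) : q ∈ A p := by
    have := mul_mem_reachableSet hm Y hp.1.2 (N.mul_mem hq (N.inv_mem hp)).1.1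
    rwa [one_mul, inv_mul_cancel_right] at this
  intro g
  refine eq_univ_of_forall fun h => ?_
  -- The system is steered from `g` to `p⁻¹` in `N`, then within `N` to `q`, then to `h`.
  obtain ⟨p, hp, hgp⟩ := exists_mul_inv_mem_reachableSet h𝒳X Y N hN
    (k := g⁻¹) (hI 1 ▸ mem_univ _)
  obtain ⟨q, hq, hqh⟩ := exists_mul_inv_mem_reachableSet h𝒳X Y N hN
    (k := h) (hI 1 ▸ mem_univ _)
  have h1 := hgp g
  rw [inv_mul_cancel_left] at h1
  have h2 := hqh q
  rw [mul_inv_cancel, mul_one] at h2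
  exact reachableSet_trans (reachableSet_trans h1 (hreach (N.inv_mem hp) hq)) h2
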